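/- For a real number $\beta>1$ let $T_\beta(x)=\beta x-\lfloor \beta x\rfloor$ on $[0,1)$, let $d_\beta(x)=x_1x_2\dots$ with $x_n=\lfloor \beta T_\beta^{\,n-1}(x)\rfloor$ be the greedy $\beta$-expansion of $x\in[0,1)$, and let $d_\beta(1)=\lim_{\varepsilon\downarrow 0} d_\beta(1-\varepsilon)$ (letterwise limit) be the expansion of one. An infinite word is $(m,p)$-periodic if it has the form $x_1\dots x_m(x_{m+1}\dots x_{m+p})^\infty$ with $m\ge 0$ and $p\ge 1$ both minimal. The number $\beta$ is a Parry number if $d_\beta(1)$ is eventually periodic. A Salem number is an algebraic integer $\beta>1$ all of whose other conjugates have modulus at most one, at least one of them having modulus exactly one. Theorem. There are constants $c(d)>0$, depending only on $d$ and satisfying $c(d)>(3d)^{-d}$, such that for every Salem number $\beta$ of degree $d$ there are infinitely many positive integers $m$ for which $\beta^m$ is a Parry number, and moreover $$\liminf_{M\to\infty}\frac{1}{M}\,\mathrm{Card}\bigl\{m\in[1,M]\cap\mathbb Z \;:\; d_{\beta^m}(1)\text{ is }(1,p)\text{-periodic for some }p\ge 1\bigr\}\;\ge\; c(d).$$ 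-/

import Mathlib

open Filter Topology

/-- A Salem number: a real algebraic integer `β > 1` all of whose conjugates other than `β` itself
have modulus at most one, at least one conjugate having modulus exactly one. -/
structure IsSalemNumber (β : ℝ) : Prop where
  one_lt : 1 < β
  isIntegral : IsIntegral ℤ β
  norm_le_one : ∀ z : ℂ, IsConjRoot ℚ (β : ℂ) z → z ≠ (β : ℂ) → ‖z‖ ≤ 1
  exists_norm_eq_one : ∃ z : ℂ, IsConjRoot ℚ (β : ℂ) z ∧ ‖z‖ = 1

/-- The beta transformation `T_β x = β x - ⌊β x⌋`. -/
noncomputable def betaMap (β x : ℝ) : ℝ := β * x - ⌊β * x⌋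

/-- The greedy expansion `d_β(x) = x₁ x₂ …` of `x ∈ [0, 1)`, where `xₙ = ⌊β T_β^(n-1) x⌋`.
Words are indexed from `0` here, so the letter of index `n` is `xₙ₊₁`. -/
noncomputable def betaExpansion (β x : ℝ) : ℕ → ℕ :=
  fun n => ⌊β * (betaMap β)^[n] x⌋₊

/-- `c` is the expansion of one, `d_β(1) = lim_{ε ↓ 0} d_β(1 - ε)`, the limit being taken in the
space of infinite words (product of discrete topologies). -/
def IsExpansionOfOne (β : ℝ) (c : ℕ → ℕ) : Prop :=
  Tendsto (fun ε : ℝ => betaExpansion β (1 - ε)) (𝓝[>] 0) (𝓝 c)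

/-- The word `x` has the form `x₁ … xₘ (xₘ₊₁ … xₘ₊ₚ)^∞`, with `p ≥ 1`. -/
def IsEventuallyPeriodicWord (x : ℕ → ℕ) (m p : ℕ) : Prop :=
  1 ≤ p ∧ ∀ i, m ≤ i → x (i + p) = x i

/-- The word `x` is `(m, p)`-periodic: it is eventually periodic, and `m` and `p` are the minimal
preperiod and period. -/
def IsPeriodicWord (x : ℕ → ℕ) (m p : ℕ) : Prop :=
  IsEventuallyPeriodicWord x m p ∧
    ∀ m' p', IsEventuallyPeriodicWord x m' p' → m ≤ m' ∧ p ≤ p'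

/-- A Parry number: `β > 1` such that `d_β(1)` is eventually periodic. -/
def IsParryNumber (β : ℝ) : Prop :=
  1 < β ∧ ∃ c, IsExpansionOfOne β c ∧ ∃ m p, IsEventuallyPeriodicWord c m p

/-- `d_β(1)` is `(1, p)`-periodic for some `p`. -/
def HasOnePeriodicExpansion (β : ℝ) : Prop :=
  ∃ c, IsExpansionOfOne β c ∧ ∃ p, IsPeriodicWord c 1 p

/-! A Salem number `β` of degree `d = 2k + 2` has the conjugates `β`, `β⁻¹` and `k` pairs
`exp(±iθ_j)`. For `B = β ^ m` the minimal polynomial is `P = (X² - (B + B⁻¹)X + 1) Q` with `Q = ∏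
(X² - 2 cos(mθ_j) X + 1)`.

If the inner coefficients of `Q` lie well inside `(0, 1)` and `B` is large, then `P = X^d - D
X^(d-1) - a_(d-2) X^(d-2) - ⋯ - a_2 X² - D X + 1` with `0 ≤ a_j < D`. The equation `P(B) = 0` then
says that `D (a_(d-2) … a_2 (D-1)(D-1))^∞` has value `1` in base `B`. Since every later digit is
below `D < B`, all proper tails are below `1`, so this word is the expansion of one
(`hasOnePeriodicExpansion_of_coeff`).

It remains to see how often `Q` is good. The numbers `θ_j / 2π` together with `1` are independent
over `ℤ` (`arg_independent`): a conjugation taking one `exp(iθ_j)` to `β` keeps the others on the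
unit circle, so absolute values kill its exponent in any relation. By Weyl, the density of good `m`
is at least the volume of any open set of good angles (`eventually_le_ncard_visits`).

Such a set surrounds the zeros of `halfPoly k`, whose inner coefficients are all `1/2`. Its zeros
interlace with the `2k`-th roots of unity, where its mean modulus is `2`. Moving each angle by at
most `π / (70 (k+1)²)` changes the values there by a relative amount at most `0.235`, hence each
coefficient by at most `0.47` (`exists_angles_coeff_mem`). As cosine is even, every angle has two
arcs, of total relative length `1 / (35 (k+1)²)`; the product of these lengths exceeds `(36
(k+1)²)^(-k) = (3d)^(2-d)`. -/

/-! ### Weyl equidistribution on the torus. -/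

section Equidistribution

open MeasureTheory UnitAddTorus

variable {ι : Type*} [Fintype ι]

lemma mFourier_nsmul (n : ι → ℤ) (m : ℕ) (x : UnitAddTorus ι) :
    mFourier n (m • x) = mFourier n x ^ m := by
  simp only [mFourier, ContinuousMap.coe_mk, Pi.smul_apply, fourier_apply, ← Finset.prod_pow]
  refine Finset.prod_congr rfl fun i _ => ?_
  rw [smul_comm, AddCircle.toCircle_nsmul, Circle.coe_pow]

lemma mFourier_add_apply (n : ι → ℤ) (x y : UnitAddTorus ι) :
    mFourier n (x + y) = mFourier n x * mFourier n y := by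
  simp only [mFourier, ContinuousMap.coe_mk, Pi.add_apply, fourier_apply, smul_add,
    AddCircle.toCircle_add, Circle.coe_mul, Finset.prod_mul_distrib]

lemma mFourier_eq_toCircle (n : ι → ℤ) (x : UnitAddTorus ι) :
    mFourier n x = (AddCircle.toCircle (∑ i, n i • x i) : ℂ) := by
  classical
  simp only [mFourier, ContinuousMap.coe_mk, fourier_apply]
  induction (Finset.univ : Finset ι) using Finset.induction_on with
  | empty => simp [AddCircle.toCircle_zero]
  | insert a s ha ih => rw [Finset.prod_insert ha, Finset.sum_insert ha, AddCircle.toCircle_add, ih,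
      Circle.coe_mul]

lemma norm_mFourier_apply (n : ι → ℤ) (x : UnitAddTorus ι) : ‖mFourier n x‖ = 1 := by
  rw [mFourier_eq_toCircle]; exact Circle.norm_coe _

lemma mFourier_ne_one {t : UnitAddTorus ι} (ht : ∀ n : ι → ℤ, ∑ i, n i • t i = 0 → n = 0)
    {n : ι → ℤ} (hn : n ≠ 0) : mFourier n t ≠ 1 := by
  intro h
  refine hn (ht n ?_)
  rw [mFourier_eq_toCircle] at h
  apply AddCircle.injective_toCircle (T := (1 : ℝ)) one_ne_zero
  rw [AddCircle.toCircle_zero]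
  exact Subtype.ext h

lemma isProbabilityMeasure_unitAddTorus :
    IsProbabilityMeasure (volume : Measure (UnitAddTorus ι)) := by
  have : IsProbabilityMeasure (volume : Measure UnitAddCircle) :=
    ⟨by rw [AddCircle.measure_univ, ENNReal.ofReal_one]⟩
  exact inferInstanceAs (IsProbabilityMeasure (Measure.pi fun _ : ι => volume))

/-- Translation by `t` multiplies the integral by the value of the character at `t`, yet leaves it
unchanged by invariance. -/
lemma integral_mFourier_of_ne_one {t : UnitAddTorus ι} {n : ι → ℤ} (hn : mFourier n t ≠ 1) :
    ∫ x : UnitAddTorus ι, mFourier n x = 0 := by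
  have h := integral_add_left_eq_self (μ := (volume : Measure (UnitAddTorus ι)))
    (fun x => mFourier n x) t
  simp only [mFourier_add_apply] at h
  rw [integral_const_mul] at h
  by_contra h0
  exact hn (mul_right_cancel₀ h0 (by rw [h, one_mul]))

/-- Weyl equidistribution of the multiples of a generic point of the torus. -/
theorem tendsto_average_torus {t : UnitAddTorus ι}
    (ht : ∀ n : ι → ℤ, ∑ i, n i • t i = 0 → n = 0) (f : C(UnitAddTorus ι, ℂ)) :
    Tendsto (fun M : ℕ => ((M : ℂ) + 1)⁻¹ * ∑ m ∈ Finset.range (M + 1), f ((m + 1) • t)) atTop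
      (𝓝 (∫ x, f x)) := by
  have := isProbabilityMeasure_unitAddTorus (ι := ι)
  -- Characters suffice, since trigonometric polynomials are uniformly dense.
  have key : ∀ f ∈ Submodule.span ℂ (Set.range (mFourier (d := ι))),
      Tendsto (fun M : ℕ => ((M : ℂ) + 1)⁻¹ * ∑ m ∈ Finset.range (M + 1), f ((m + 1) • t)) atTop
      (𝓝 (∫ x, f x)) := by
    intro f hf
    induction hf using Submodule.span_induction with
    | mem f hf =>
      obtain ⟨n, rfl⟩ := hf
      by_cases hn : n = 0
      · subst hn
        simp only [mFourier_zero, ContinuousMap.one_apply, Finset.sum_const, Finset.card_range,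
          integral_const, nsmul_eq_mul, mul_one]
        have : (volume : Measure (UnitAddTorus ι)).real Set.univ = 1 := by simp
        rw [this, one_smul]
        refine tendsto_const_nhds.congr fun M => ?_
        push_cast
        rw [inv_mul_cancel₀]
        exact_mod_cast M.succ_ne_zero
      · have h1 := mFourier_ne_one ht hn
        rw [integral_mFourier_of_ne_one h1]
        set z := mFourier n t with hz
        have hz1 : ‖z‖ = 1 := norm_mFourier_apply n t
        have hz0 : z - 1 ≠ 0 := sub_ne_zero.2 h1
        -- For a nontrivial character the sum is geometric, hence bounded independently of `M`.
        have hsum : ∀ M : ℕ, ∑ m ∈ Finset.range (M + 1), mFourier n ((m + 1) • t)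
            = z * ((z ^ (M + 1) - 1) / (z - 1)) := by
          intro M
          rw [← geom_sum_eq h1, Finset.mul_sum]
          refine Finset.sum_congr rfl fun m _ => ?_
          rw [mFourier_nsmul, pow_succ']
        have hb : ∀ M : ℕ, ‖z * ((z ^ (M + 1) - 1) / (z - 1))‖ ≤ 2 / ‖z - 1‖ := by
          intro M
          rw [norm_mul, hz1, one_mul, norm_div]
          gcongr
          refine (norm_sub_le _ _).trans ?_
          rw [norm_pow, hz1]; norm_num
        have hlim : Tendsto (fun M : ℕ => ((M : ℝ) + 1)⁻¹ * (2 / ‖z - 1‖)) atTop (𝓝 0) := by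
          have := tendsto_one_div_add_atTop_nhds_zero_nat (𝕜 := ℝ)
          simpa using this.mul_const (2 / ‖z - 1‖)
        refine squeeze_zero_norm (fun M => ?_) hlim
        rw [hsum, norm_mul]
        have : ‖((M : ℂ) + 1)⁻¹‖ = ((M : ℝ) + 1)⁻¹ := by
          rw [norm_inv]; congr 1
          have : ((M : ℂ) + 1) = ((M + 1 : ℕ) : ℂ) := by push_cast; rfl
          rw [this, Complex.norm_natCast]; push_cast; rfl
        rw [this]
        gcongr
        exact hb M
    | zero => simp
    | add f g _ _ hf hg =>
      have hi : ∀ f : C(UnitAddTorus ι, ℂ), Integrable f := fun f =>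
        f.continuous.integrable_of_hasCompactSupport (HasCompactSupport.of_compactSpace _)
      simp only [ContinuousMap.add_apply]
      rw [integral_add (hi f) (hi g)]
      refine (hf.add hg).congr fun M => ?_
      rw [Finset.sum_add_distrib, mul_add]
    | smul c f _ hf =>
      simp only [ContinuousMap.smul_apply, smul_eq_mul]
      rw [integral_const_mul]
      refine (hf.const_mul c).congr fun M => ?_
      rw [← Finset.mul_sum]; ring
  have hdense : f ∈ (Submodule.span ℂ (Set.range (mFourier (d := ι)))).topologicalClosure := by
    rw [span_mFourier_closure_eq_top]; trivial
  rw [← SetLike.mem_coe, Submodule.topologicalClosure_coe, Metric.mem_closure_iff] at hdense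
  rw [Metric.tendsto_atTop]
  intro ε hε
  obtain ⟨g, hg, hfg⟩ := hdense (ε / 3) (by positivity)
  rw [dist_eq_norm] at hfg
  obtain ⟨N, hN⟩ := Metric.tendsto_atTop.1 (key g hg) (ε / 3) (by positivity)
  refine ⟨N, fun M hM => ?_⟩
  have hpt : ∀ x, ‖f x - g x‖ ≤ ε / 3 := fun x =>
    ((f - g).norm_coe_le_norm x).trans hfg.le
  have h1 : ‖((M : ℂ) + 1)⁻¹ * ∑ m ∈ Finset.range (M + 1), f ((m + 1) • t) -
      ((M : ℂ) + 1)⁻¹ * ∑ m ∈ Finset.range (M + 1), g ((m + 1) • t)‖ ≤ ε / 3 := by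
    rw [← mul_sub, ← Finset.sum_sub_distrib, norm_mul]
    have h2 : ‖∑ m ∈ Finset.range (M + 1), (f ((m + 1) • t) - g ((m + 1) • t))‖
        ≤ (M + 1 : ℝ) * (ε / 3) := by
      refine (norm_sum_le _ _).trans ((Finset.sum_le_sum fun m _ => hpt _).trans ?_)
      simp
    have : ‖((M : ℂ) + 1)⁻¹‖ = ((M : ℝ) + 1)⁻¹ := by
      rw [norm_inv]; congr 1
      have : ((M : ℂ) + 1) = ((M + 1 : ℕ) : ℂ) := by push_cast; rfl
      rw [this, Complex.norm_natCast]; push_cast; rfl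
    rw [this]
    calc _ ≤ ((M : ℝ) + 1)⁻¹ * ((M + 1 : ℝ) * (ε / 3)) := by gcongr
      _ = ε / 3 := by field_simp
  have h3 : ‖(∫ x, g x) - ∫ x, f x‖ ≤ ε / 3 := by
    have hi : ∀ f : C(UnitAddTorus ι, ℂ), Integrable f := fun f =>
        f.continuous.integrable_of_hasCompactSupport (HasCompactSupport.of_compactSpace _)
    rw [← integral_sub (hi g) (hi f)]
    refine (norm_integral_le_of_norm_le_const (C := ε / 3)
      (Eventually.of_forall fun x => ?_)).trans ?_
    · rw [norm_sub_rev]; exact hpt x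
    · simp
  have h4 := hN M hM
  rw [dist_eq_norm] at h4 ⊢
  calc _ = ‖(((M : ℂ) + 1)⁻¹ * ∑ m ∈ Finset.range (M + 1), f ((m + 1) • t) -
      ((M : ℂ) + 1)⁻¹ * ∑ m ∈ Finset.range (M + 1), g ((m + 1) • t)) +
      (((M : ℂ) + 1)⁻¹ * ∑ m ∈ Finset.range (M + 1), g ((m + 1) • t) - ∫ x, g x) +
      ((∫ x, g x) - ∫ x, f x)‖ := by congr 1; ring
    _ < ε := by
      refine (norm_add₃_le).trans_lt ?_
      linarith

/-- The multiples of a generic point visit an open set with frequency at least its volume. -/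
theorem eventually_le_ncard_visits {t : UnitAddTorus ι}
    (ht : ∀ n : ι → ℤ, ∑ i, n i • t i = 0 → n = 0) {U : Set (UnitAddTorus ι)} (hU : IsOpen U)
    {c : ℝ} (hc0 : 0 ≤ c) (hc : ENNReal.ofReal c < volume U) :
    ∀ᶠ M : ℕ in atTop, c * M ≤ ({m : ℕ | 1 ≤ m ∧ m ≤ M ∧ m • t ∈ U}.ncard : ℝ) := by
  classical
  have := isProbabilityMeasure_unitAddTorus (ι := ι)
  let μs : ℕ → Measure (UnitAddTorus ι) := fun M =>
    ((M : ENNReal) + 1)⁻¹ • ∑ m ∈ Finset.range (M + 1), Measure.dirac ((m + 1) • t)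
  have hprob : ∀ M, IsProbabilityMeasure (μs M) := by
    intro M
    constructor
    simp only [μs, Measure.smul_apply, Measure.finsetSum_apply, measure_univ, Finset.sum_const,
      Finset.card_range, smul_eq_mul, nsmul_eq_mul, mul_one]
    push_cast
    exact ENNReal.inv_mul_cancel (by simp) (by simp)
  let ps : ℕ → ProbabilityMeasure (UnitAddTorus ι) := fun M => ⟨μs M, hprob M⟩
  let p : ProbabilityMeasure (UnitAddTorus ι) := ⟨volume, inferInstance⟩
  have hlim : Tendsto ps atTop (𝓝 p) := by
    rw [ProbabilityMeasure.tendsto_iff_forall_integral_tendsto]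
    intro f
    let g : C(UnitAddTorus ι, ℂ) := ⟨fun x => (f x : ℂ), by fun_prop⟩
    have h := tendsto_average_torus ht g
    have h' := (Complex.continuous_re.tendsto _).comp h
    have e1 : (∫ x, g x).re = ∫ x, f x := by
      change (∫ x, ((f x : ℝ) : ℂ)).re = _
      rw [integral_complex_ofReal, Complex.ofReal_re]
    rw [e1] at h'
    refine h'.congr fun M => ?_
    change _ = ∫ x, f x ∂(μs M)
    simp only [μs]
    rw [integral_smul_measure, integral_finsetSum_measure]
    · simp only [integral_dirac]
      simp only [Function.comp]
      have : ((M : ℂ) + 1)⁻¹ * ∑ m ∈ Finset.range (M + 1), g ((m + 1) • t) =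
        ((((M : ℝ) + 1)⁻¹ * ∑ m ∈ Finset.range (M + 1), f ((m + 1) • t) : ℝ) : ℂ) := by
        push_cast; rfl
      rw [this, Complex.ofReal_re, smul_eq_mul]
      congr 1
      rw [ENNReal.toReal_inv, ENNReal.toReal_add (by simp) (by simp)]
      simp
    · intro i _
      exact integrable_dirac (by simp)
  -- Portmanteau: weak convergence bounds open sets from below, with no condition on the boundary of
  -- `U`.
  have hle := ProbabilityMeasure.le_liminf_measure_open_of_tendsto hlim hU
  have hev : ∀ᶠ M in atTop, ENNReal.ofReal c < (ps M : Measure _) U :=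
    eventually_lt_of_lt_liminf (hc.trans_le hle)
  obtain ⟨N, hN⟩ := eventually_atTop.1 hev
  refine eventually_atTop.2 ⟨N + 1, fun M hM => ?_⟩
  obtain ⟨M, rfl⟩ : ∃ M', M = M' + 1 := ⟨M - 1, by omega⟩
  have h := hN M (by omega)
  change _ < μs M U at h
  have hval : μs M U = ((M : ENNReal) + 1)⁻¹ *
      (((Finset.range (M + 1)).filter fun m => (m + 1) • t ∈ U).card : ENNReal) := by
    simp only [μs, Measure.smul_apply, Measure.finsetSum_apply, smul_eq_mul]
    congr 1
    rw [Finset.card_filter]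
    push_cast
    refine Finset.sum_congr rfl fun m _ => ?_
    rw [Measure.dirac_apply' _ hU.measurableSet, Set.indicator_apply]
    simp
  have hcard : {m : ℕ | 1 ≤ m ∧ m ≤ M + 1 ∧ m • t ∈ U}.ncard =
      ((Finset.range (M + 1)).filter fun m => (m + 1) • t ∈ U).card := by
    rw [← Finset.card_image_of_injective _ (Nat.succ_injective), ← Set.ncard_coe_finset]
    congr 1
    ext m
    simp only [Set.mem_ofPred_eq, Finset.coe_image, Finset.coe_filter, Finset.mem_range,
      Set.mem_image]
    constructor
    · rintro ⟨h1, h2, h3⟩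
      refine ⟨m - 1, ⟨by omega, ?_⟩, by omega⟩
      rwa [Nat.sub_add_cancel h1]
    · rintro ⟨m, ⟨h1, h2⟩, rfl⟩
      exact ⟨by omega, by omega, h2⟩
  rw [hcard]
  rw [hval, mul_comm, ← ENNReal.div_eq_inv_mul.trans (mul_comm _ _),
    ENNReal.lt_div_iff_mul_lt (by simp) (by simp)] at h
  have h5 : ENNReal.ofReal (c * (M + 1)) < ENNReal.ofReal
      (((Finset.range (M + 1)).filter fun m => (m + 1) • t ∈ U).card : ℝ) := by
    rw [ENNReal.ofReal_mul hc0, ENNReal.ofReal_natCast, ENNReal.ofReal_add (by positivity)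
      (by positivity), ENNReal.ofReal_natCast, ENNReal.ofReal_one]
    exact h
  have := (ENNReal.ofReal_lt_ofReal_iff_of_nonneg (by positivity)).1 h5
  push_cast
  exact this.le

end Equidistribution

/-! ### Recognizing the expansion of one. -/

section Expansion

/-- Each `t i - ε * B ^ i` stays in `(0, 1)`, so replacing `1` by `1 - ε` does not change the
integer parts. -/
lemma iterate_betaMap_one_sub {B : ℝ} {c : ℕ → ℕ} {t : ℕ → ℝ} (h0 : t 0 = 1)
    (hrec : ∀ n, B * t n = c n + t (n + 1)) (hlt : ∀ n, t (n + 1) < 1) {ε : ℝ} (hε : 0 < ε)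
    (hB : 0 < B) {n : ℕ} (hn : ∀ i ≤ n, ε * B ^ i < t i) :
    (betaMap B)^[n] (1 - ε) = t n - ε * B ^ n := by
  induction n with
  | zero => simp [h0]
  | succ n ih =>
    rw [Function.iterate_succ_apply', ih fun i hi => hn i (by omega)]
    have h1 : B * (t n - ε * B ^ n) = (c n : ℤ) + (t (n + 1) - ε * B ^ (n + 1)) := by
      rw [mul_sub, hrec]; push_cast; ring
    have h2 := hn (n + 1) le_rfl
    have h3 := hlt n
    have h4 : 0 < ε * B ^ (n + 1) := by positivity
    rw [betaMap, h1, Int.floor_intCast_add, Int.floor_eq_zero_iff.2 ⟨by linarith, by linarith⟩]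
    push_cast; ring

/-- A word whose tails `t n` lie in `(0, 1)` for `n ≥ 1` and evaluate to `1` for `n = 0` is the
expansion of one. -/
theorem isExpansionOfOne_of_tails {B : ℝ} (hB : 0 < B) {c : ℕ → ℕ} {t : ℕ → ℝ} (h0 : t 0 = 1)
    (hrec : ∀ n, B * t n = c n + t (n + 1)) (hpos : ∀ n, 0 < t n) (hlt : ∀ n, t (n + 1) < 1) :
    IsExpansionOfOne B c := by
  rw [IsExpansionOfOne, tendsto_pi_nhds]
  intro n
  rw [nhds_discrete, tendsto_pure]
  have hev : ∀ i, ∀ᶠ ε : ℝ in 𝓝[>] 0, ε * B ^ i < t i := by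
    intro i
    have : Tendsto (fun ε : ℝ => ε * B ^ i) (𝓝 0) (𝓝 (0 * B ^ i)) :=
      (continuous_id.mul continuous_const).tendsto _
    rw [zero_mul] at this
    exact (this.mono_left nhdsWithin_le_nhds).eventually (gt_mem_nhds (hpos i))
  have hall : ∀ᶠ ε : ℝ in 𝓝[>] 0, ∀ i ∈ Finset.range (n + 2), ε * B ^ i < t i :=
    (Finset.eventually_all _).2 fun i _ => hev i
  filter_upwards [hall, self_mem_nhdsWithin] with ε h1 h2
  have hε : 0 < ε := h2
  rw [betaExpansion, iterate_betaMap_one_sub h0 hrec hlt hε hB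
    fun i hi => h1 i (Finset.mem_range.2 (by omega))]
  have h3 : B * (t n - ε * B ^ n) = (c n : ℝ) + (t (n + 1) - ε * B ^ (n + 1)) := by
    rw [mul_sub, hrec]; ring
  have h4 := h1 (n + 1) (Finset.mem_range.2 (by omega))
  have h5 : 0 < ε * B ^ (n + 1) := by positivity
  have h6 := hlt n
  rw [h3, Nat.floor_eq_iff (by have := (Nat.cast_nonneg (α := ℝ) (c n)); linarith)]
  constructor <;> linarith

/-- The value `∑ xₙ₊ᵢ B^(-i-1)` of the `n`-th tail of a word in base `B`. -/
noncomputable def tailValue (B : ℝ) (x : ℕ → ℕ) (n : ℕ) : ℝ :=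
  ∑' i, (x (n + i) : ℝ) * B⁻¹ ^ (i + 1)

lemma summable_tailValue {B : ℝ} (hB : 1 < B) {x : ℕ → ℕ} {D : ℝ} (hx : ∀ n, (x n : ℝ) ≤ D)
    (n : ℕ) : Summable fun i => (x (n + i) : ℝ) * B⁻¹ ^ (i + 1) := by
  have hB0 : 0 < B := by linarith
  have hg : Summable fun i => D * B⁻¹ ^ (i + 1) :=
    ((summable_nat_add_iff 1).2
      (summable_geometric_of_lt_one (by positivity) (inv_lt_one_of_one_lt₀ hB))).mul_left D
  exact hg.of_nonneg_of_le (fun i => by positivity) fun i => by gcongr; exact hx _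

lemma mul_tailValue {B : ℝ} (hB : 1 < B) {x : ℕ → ℕ} {D : ℝ} (hx : ∀ n, (x n : ℝ) ≤ D) (n : ℕ) :
    B * tailValue B x n = x n + tailValue B x (n + 1) := by
  have hB0 : B ≠ 0 := by linarith
  rw [tailValue, (summable_tailValue hB hx n).tsum_eq_zero_add, tailValue, mul_add,
    ← tsum_mul_left]
  congr 1
  · simp; field_simp
  · refine tsum_congr fun i => ?_
    rw [show n + (i + 1) = n + 1 + i by ring, pow_succ B⁻¹ (i + 1)]
    field_simp

lemma tailValue_le {B : ℝ} (hB : 1 < B) {x : ℕ → ℕ} {D : ℝ} (hx : ∀ n, (x n : ℝ) ≤ D) (n : ℕ) :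
    tailValue B x n ≤ D / (B - 1) := by
  have hB0 : 0 < B := by linarith
  have hs := summable_geometric_of_lt_one (r := B⁻¹) (by positivity) (inv_lt_one_of_one_lt₀ hB)
  have hg : Summable fun i => D * B⁻¹ ^ (i + 1) := ((summable_nat_add_iff 1).2 hs).mul_left D
  refine ((summable_tailValue hB hx n).tsum_le_tsum
    (fun i => by gcongr; exact hx _) hg).trans_eq ?_
  have h1 : B - 1 ≠ 0 := by linarith
  simp_rw [pow_succ, ← mul_assoc]
  rw [tsum_mul_right, tsum_mul_left, tsum_geometric_of_lt_one (by positivity)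
    (inv_lt_one_of_one_lt₀ hB)]
  rw [one_sub_inv_eq hB0.ne']
  field_simp
where one_sub_inv_eq {B : ℝ} (h : B ≠ 0) : 1 - B⁻¹ = (B - 1) / B := by field_simp

lemma tailValue_pos {B : ℝ} (hB : 1 < B) {x : ℕ → ℕ} {D : ℝ} (hx : ∀ n, (x n : ℝ) ≤ D) {n i : ℕ}
    (hi : x (n + i) ≠ 0) : 0 < tailValue B x n := by
  have hB0 : 0 < B := by linarith
  refine lt_of_lt_of_le ?_ ((summable_tailValue hB hx n).le_tsum i fun j _ => by positivity)
  have : 0 < (x (n + i) : ℝ) := by exact_mod_cast Nat.pos_of_ne_zero hi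
  positivity

lemma pow_mul_tailValue {B : ℝ} (hB : 1 < B) {x : ℕ → ℕ} {D : ℝ} (hx : ∀ n, (x n : ℝ) ≤ D)
    (p : ℕ) : B ^ p * tailValue B x 0 =
      ∑ i ∈ Finset.range p, (x i : ℝ) * B ^ (p - 1 - i) + tailValue B x p := by
  induction p with
  | zero => simp
  | succ p ih =>
    rw [pow_succ', mul_assoc, ih, mul_add, mul_tailValue hB hx, Finset.sum_range_succ,
      Finset.mul_sum, ← add_assoc]
    congr 2
    · refine Finset.sum_congr rfl fun i hi => ?_
      have := Finset.mem_range.1 hi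
      rw [show p + 1 - 1 - i = p - 1 - i + 1 by omega, pow_succ]; ring
    · simp

/-- If `D` strictly exceeds all later digits of a word with purely periodic tail, then its period
and preperiod `1` are witnessed by a minimal pair. -/
lemma exists_isPeriodicWord_one {c : ℕ → ℕ} {p : ℕ} (hp : 1 ≤ p)
    (hper : ∀ i, c (i + 1 + p) = c (i + 1)) (hlt : ∀ i, c (i + 1) < c 0) :
    ∃ p, IsPeriodicWord c 1 p := by
  classical
  have hex : ∃ p, IsEventuallyPeriodicWord c 1 p :=
    ⟨p, hp, fun i hi => by obtain ⟨j, rfl⟩ := Nat.exists_eq_add_of_le' hi; exact hper j⟩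
  refine ⟨Nat.find hex, Nat.find_spec hex, fun m' p' h => ⟨?_, ?_⟩⟩
  -- With preperiod `0` the letter `c 0` would recur, but it exceeds all later letters.
  · by_contra! hm
    have h0 := h.2 0 (by omega)
    obtain ⟨q, rfl⟩ := Nat.exists_eq_add_of_le' h.1
    have := hlt q
    rw [zero_add] at h0
    omega
  · refine Nat.find_min' hex ⟨h.1, fun i hi => ?_⟩
    -- Shifting by a multiple of `p` beyond `m'` makes the period `p'` valid from index `1` on.
    have hN : ∀ N j, c (j + 1 + N * p) = c (j + 1) := by
      intro N
      induction N with
      | zero => simp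
      | succ N ih =>
        intro j
        rw [← ih j, show j + 1 + (N + 1) * p = j + N * p + 1 + p by ring, hper (j + N * p)]
        congr 1; ring
    obtain ⟨j, rfl⟩ := Nat.exists_eq_add_of_le' hi
    have h1 := hN m' (j + p')
    have h2 := hN m' j
    have h3 := h.2 (j + 1 + m' * p) (by nlinarith)
    rw [show j + 1 + p' = j + p' + 1 by ring, ← h1, ← h2, ← h3]
    congr 1; ring

/-- A word `D (x₀ … xₚ₋₁)^∞` with all `xᵢ < D`, not all zero, whose value in base `B` is `1` is the
expansion of one, and it is `(1, q)`-periodic for some `q`. -/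
theorem hasOnePeriodicExpansion_of_word {B : ℝ} (hB : 1 < B) {D p : ℕ} {x : ℕ → ℕ} (hp : 1 ≤ p)
    (hper : ∀ i, x (i + p) = x i) (hlt : ∀ i, x i < D) (hne : ∃ i, x i ≠ 0)
    (hval : (B ^ p - 1) * (B - D) = ∑ i ∈ Finset.range p, (x i : ℝ) * B ^ (p - 1 - i)) :
    HasOnePeriodicExpansion B := by
  have hx : ∀ n, (x n : ℝ) ≤ (D : ℝ) - 1 := by
    intro n
    have : ((x n + 1 : ℕ) : ℝ) ≤ D := by exact_mod_cast hlt n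
    push_cast at this; linarith
  have hN : ∀ N j, x (j + N * p) = x j := by
    intro N
    induction N with
    | zero => simp
    | succ N ih =>
      intro j
      rw [← ih j, ← hper (j + N * p)]
      congr 1; ring
  have hpos : ∀ n, 0 < tailValue B x n := by
    intro n
    obtain ⟨i, hi⟩ := hne
    obtain ⟨k, hk⟩ := Nat.exists_eq_add_of_le (show n ≤ i + n * p by nlinarith)
    refine tailValue_pos hB hx (i := k) ?_
    rw [← hk, hN]; exact hi
  have hp0 : tailValue B x p = tailValue B x 0 := by
    simp only [tailValue]
    refine tsum_congr fun i => ?_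
    rw [add_comm p i, hper, zero_add]
  have hs0 : tailValue B x 0 = B - D := by
    have h1 := pow_mul_tailValue hB hx p
    rw [hp0, ← hval] at h1
    have h2 : B ^ p - 1 ≠ 0 := by
      have := one_lt_pow₀ hB (show p ≠ 0 by omega); linarith
    apply mul_left_cancel₀ h2
    linarith
  have hDB : (D : ℝ) < B := by have := hpos 0; rw [hs0] at this; linarith
  let c : ℕ → ℕ := fun n => Nat.casesOn n D x
  let t : ℕ → ℝ := fun n => Nat.casesOn n 1 (tailValue B x)
  refine ⟨c, isExpansionOfOne_of_tails (t := t) (by linarith) rfl ?_ ?_ ?_,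
    exists_isPeriodicWord_one hp (fun i => ?_) (fun i => hlt i)⟩
  · rintro (_ | n)
    · change B * 1 = D + tailValue B x 0
      rw [hs0]; ring
    · exact mul_tailValue hB hx n
  · rintro (_ | n)
    · exact one_pos
    · exact hpos n
  · intro n
    -- Digits at most `D - 1` give tails at most `(D - 1) / (B - 1)`, which is below `1` because `D
    -- < B`.
    refine (tailValue_le hB hx n).trans_lt ?_
    rw [div_lt_one (by linarith)]
    linarith
  · rw [show i + 1 + p = i + p + 1 by ring]
    exact hper i

end Expansion

/-! ### A reference polynomial with all zeros on the unit circle. -/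

section UnitCirclePolynomials

open Polynomial

/-- The reciprocal polynomial with roots `exp (± i ψⱼ)`. -/
noncomputable def cosPoly {ι : Type*} [Fintype ι] (ψ : ι → ℝ) : ℝ[X] :=
  ∏ j, (X ^ 2 - C (2 * Real.cos (ψ j)) * X + 1)

/-- The polynomial `X^(2k) + (X^(2k-1) + ⋯ + X) / 2 + 1`. -/
noncomputable def halfPoly (k : ℕ) : ℝ[X] :=
  X ^ (2 * k) + 1 + C (1 / 2) * ∑ i ∈ Finset.Ico 1 (2 * k), X ^ i

lemma quadratic_natDegree (a : ℝ) : (X ^ 2 - C a * X + 1 : ℝ[X]).natDegree = 2 := by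
  compute_degree!

lemma quadratic_monic (a : ℝ) : (X ^ 2 - C a * X + 1 : ℝ[X]).Monic := by
  monicity!

lemma cosPoly_monic {ι : Type*} [Fintype ι] (ψ : ι → ℝ) : (cosPoly ψ).Monic :=
  monic_prod_of_monic _ _ fun _ _ => quadratic_monic _

lemma cosPoly_natDegree {ι : Type*} [Fintype ι] (ψ : ι → ℝ) :
    (cosPoly ψ).natDegree = 2 * Fintype.card ι := by
  rw [cosPoly, natDegree_prod_of_monic _ _ fun _ _ => quadratic_monic _]
  rw [Finset.sum_congr rfl fun _ _ => quadratic_natDegree _]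
  simp [mul_comm]

lemma halfPoly_coeff {k i : ℕ} (h1 : 1 ≤ i) (h2 : i < 2 * k) : (halfPoly k).coeff i = 1 / 2 := by
  simp only [halfPoly, coeff_add, coeff_X_pow, coeff_one, coeff_C_mul, finsetSum_coeff,
    Finset.sum_ite_eq, Finset.mem_Ico]
  rw [if_neg (by omega), if_neg (by omega), if_pos ⟨h1, h2⟩]
  norm_num

lemma halfPoly_natDegree_le (k : ℕ) : (halfPoly k).natDegree ≤ 2 * k := by
  refine natDegree_add_le_of_degree_le (natDegree_add_le_of_degree_le (natDegree_X_pow_le _) ?_)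
    ((natDegree_C_mul_le _ _).trans (natDegree_sum_le_of_forall_le _ _ fun i hi => ?_))
  · simp
  · rw [natDegree_X_pow]; exact (Finset.mem_Ico.1 hi).2.le

lemma halfPoly_monic {k : ℕ} (hk : 1 ≤ k) : (halfPoly k).Monic := by
  refine monic_of_natDegree_le_of_coeff_eq_one (2 * k) (halfPoly_natDegree_le k) ?_
  simp only [halfPoly, coeff_add, coeff_X_pow, coeff_one, coeff_C_mul, finsetSum_coeff,
    Finset.sum_ite_eq, Finset.mem_Ico]
  rw [if_pos trivial, if_neg (by omega), if_neg (by omega)]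
  norm_num

lemma aeval_halfPoly (k : ℕ) (z : ℂ) :
    aeval z (halfPoly k) = z ^ (2 * k) + 1 + (1 / 2) * ∑ i ∈ Finset.Ico 1 (2 * k), z ^ i := by
  simp [halfPoly]

lemma sub_one_mul_aeval_halfPoly {k : ℕ} (hk : 1 ≤ k) (z : ℂ) : (z - 1) * aeval z (halfPoly k) =
    z ^ (2 * k) * z - z ^ (2 * k) / 2 + z / 2 - 1 := by
  have h := geom_sum_Ico_mul z (show 1 ≤ 2 * k by omega)
  rw [aeval_halfPoly]
  linear_combination (1 / 2 : ℂ) * h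

lemma aeval_halfPoly_of_pow_eq_one {k : ℕ} (hk : 1 ≤ k) {z : ℂ} (hz : z ^ (2 * k) = 1)
    (h1 : z ≠ 1) : aeval z (halfPoly k) = 3 / 2 := by
  have h := sub_one_mul_aeval_halfPoly hk z
  rw [hz] at h
  apply mul_left_cancel₀ (sub_ne_zero.2 h1)
  rw [h]; ring

lemma aeval_one_halfPoly {k : ℕ} (hk : 1 ≤ k) : aeval (1 : ℂ) (halfPoly k) = k + 3 / 2 := by
  rw [aeval_halfPoly]
  simp only [one_pow, Finset.sum_const, Nat.card_Ico, nsmul_eq_mul]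
  rw [Nat.cast_sub (by omega)]
  push_cast; ring

lemma aeval_cosPoly {ι : Type*} [Fintype ι] (ψ : ι → ℝ) (α : ℝ) :
    aeval (Complex.exp (α * Complex.I)) (cosPoly ψ) =
      Complex.exp (α * Complex.I) ^ Fintype.card ι *
        ((∏ j, (2 * Real.cos α - 2 * Real.cos (ψ j)) : ℝ) : ℂ) := by
  rw [cosPoly, map_prod]
  push_cast
  rw [← Finset.card_univ, ← Finset.prod_const, ← Finset.prod_mul_distrib]
  refine Finset.prod_congr rfl fun j _ => ?_
  simp only [map_add, map_sub, map_mul, map_pow, aeval_X, aeval_C, map_one]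
  have h1 : Complex.exp (α * Complex.I) * Complex.exp (-α * Complex.I) = 1 := by
    rw [← Complex.exp_add]; simp
  rw [Complex.cos, Complex.cos]
  simp only [Complex.coe_algebraMap, Complex.ofReal_ofNat, Complex.ofReal_cos,
    Complex.cos]
  linear_combination -h1

/-- Extracting a phase leaves a real trigonometric function, whose zeros can be located by sign
changes. -/
lemma coe_aeval_halfPoly_exp {k : ℕ} (hk : 1 ≤ k) (φ : ℝ) :
    (Complex.exp (φ * Complex.I) - 1) * aeval (Complex.exp (φ * Complex.I)) (halfPoly k) =
      Complex.I * Complex.exp ((k + 1 / 2) * φ * Complex.I) *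
        ((3 * Real.cos (k * φ) * Real.sin (φ / 2) +
          Real.sin (k * φ) * Real.cos (φ / 2) : ℝ) : ℂ) := by
  rw [sub_one_mul_aeval_halfPoly hk]
  set x := Complex.exp (φ / 2 * Complex.I) with hx
  set y := Complex.exp (k * φ * Complex.I) with hy
  have h1 : Complex.exp (φ * Complex.I) = x ^ 2 := by
    rw [hx, ← Complex.exp_nat_mul]; congr 1; push_cast; ring
  have h2 : (x ^ 2) ^ (2 * k) = y ^ 2 := by
    rw [← h1, hy, ← Complex.exp_nat_mul, ← Complex.exp_nat_mul]; congr 1; push_cast; ring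
  have h3 : Complex.exp ((k + 1 / 2) * φ * Complex.I) = y * x := by
    rw [hx, hy, ← Complex.exp_add]; congr 1; ring
  have hx' : Complex.exp (-(φ / 2) * Complex.I) = x⁻¹ := by
    rw [hx, ← Complex.exp_neg]; congr 1; ring
  have hy' : Complex.exp (-(k * φ) * Complex.I) = y⁻¹ := by
    rw [hy, ← Complex.exp_neg]; congr 1; ring
  have hx0 : x ≠ 0 := Complex.exp_ne_zero _
  have hy0 : y ≠ 0 := Complex.exp_ne_zero _
  rw [h1, h2, h3]
  push_cast
  rw [Complex.cos, Complex.cos, Complex.sin, Complex.sin, hx', hy', ← hx, ← hy]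
  field_simp
  linear_combination -(-4 * y ^ 2 * x ^ 2 + 2 * y ^ 2 - 2 * x ^ 2 + 4) * Complex.I_sq

/-- With `kφ = Jπ - u` the zeros satisfy `tan u = 3 tan (φ/2)`. At the left end `u ≤ φ/2`, at the
right end `cos u = 0`, and the intermediate value theorem applies. The lower bound on `u` keeps `φ`
away from `Jπ/k`. -/
lemma exists_halfPoly_angle {k J : ℕ} (hJ : 1 ≤ J) (hJk : J ≤ k) :
    ∃ u : ℝ, Real.pi / (3 * k) ≤ u ∧ u ≤ Real.pi / 2 ∧
      3 * Real.cos u * Real.sin ((J * Real.pi - u) / k / 2) =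
        Real.sin u * Real.cos ((J * Real.pi - u) / k / 2) := by
  have hk1 : (1 : ℝ) ≤ k := by exact_mod_cast hJ.trans hJk
  have hJ1 : (1 : ℝ) ≤ J := by exact_mod_cast hJ
  have hJk' : (J : ℝ) ≤ k := by exact_mod_cast hJk
  have hpi := Real.pi_pos
  let g : ℝ → ℝ := fun u => 3 * Real.cos u * Real.sin ((J * Real.pi - u) / k / 2) -
    Real.sin u * Real.cos ((J * Real.pi - u) / k / 2)
  have hg : Continuous g := by fun_prop
  have hle : Real.pi / (3 * k) ≤ Real.pi / 2 := by
    gcongr; linarith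
  have hv : ∀ u, 0 ≤ u → (J * Real.pi - u) / k / 2 ≤ Real.pi / 2 := by
    intro u hu
    gcongr
    rw [div_le_iff₀ (by linarith)]
    nlinarith
  have ha : 0 ≤ g (Real.pi / (3 * k)) := by
    set u := Real.pi / (3 * k) with hu
    have hu0 : 0 < u := by positivity
    have huk : u * (3 * k) = Real.pi := by rw [hu]; field_simp
    set v := (J * Real.pi - u) / k / 2 with hvdef
    have huv : u ≤ v := by
      rw [hvdef, div_div, le_div_iff₀ (by linarith)]
      nlinarith
    have hvp : v ≤ Real.pi / 2 := hv u hu0.le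
    have h1 : 0 ≤ Real.cos u := Real.cos_nonneg_of_mem_Icc ⟨by linarith, by linarith⟩
    have h2 : 0 ≤ Real.sin v := Real.sin_nonneg_of_mem_Icc ⟨by linarith, by linarith⟩
    have h3 : 0 ≤ Real.sin (v - u) := Real.sin_nonneg_of_mem_Icc ⟨by linarith, by linarith⟩
    rw [Real.sin_sub] at h3
    change 0 ≤ 3 * Real.cos u * Real.sin v - Real.sin u * Real.cos v
    nlinarith [mul_nonneg h1 h2]
  have hb : g (Real.pi / 2) ≤ 0 := by
    have h1 : 0 ≤ Real.cos ((J * Real.pi - Real.pi / 2) / k / 2) := by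
      refine Real.cos_nonneg_of_mem_Icc ⟨?_, hv _ (by positivity)⟩
      have : 0 ≤ (J * Real.pi - Real.pi / 2) / k / 2 := by
        have : 0 ≤ J * Real.pi - Real.pi / 2 := by nlinarith
        positivity
      linarith
    simp only [g, Real.cos_pi_div_two, Real.sin_pi_div_two]
    linarith
  obtain ⟨u, hu, hu0⟩ := intermediate_value_Icc' hle hg.continuousOn ⟨hb, ha⟩
  exact ⟨u, hu.1, hu.2, sub_eq_zero.1 hu0⟩

lemma isCoprime_quadratic {a b : ℝ} (h : a ≠ b) :
    IsCoprime (X ^ 2 - C a * X + 1 : ℝ[X]) (X ^ 2 - C b * X + 1) := by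
  have hab : b - a ≠ 0 := sub_ne_zero.2 h.symm
  refine ⟨-(X - C b) * C (b - a)⁻¹, 1 + (X - C b) * C (b - a)⁻¹, ?_⟩
  have h1 : (C (b - a)⁻¹ : ℝ[X]) * (C b - C a) = 1 := by
    rw [← C_sub, ← C_mul, inv_mul_cancel₀ hab, C_1]
  linear_combination (-X * (X - C b)) * h1

/-- Factorization of `halfPoly k`, with separated angles. -/
theorem exists_halfPoly_eq_cosPoly {k : ℕ} (hk : 1 ≤ k) :
    ∃ u : Fin k → ℝ, (∀ j, Real.pi / (3 * k) ≤ u j ∧ u j ≤ Real.pi / 2) ∧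
      halfPoly k = cosPoly fun j : Fin k => (((j : ℕ) + 1) * Real.pi - u j) / k := by
  have hk1 : (1 : ℝ) ≤ k := by exact_mod_cast hk
  have hpi := Real.pi_pos
  choose u hu1 hu2 hu3 using fun j : Fin k =>
    exists_halfPoly_angle (k := k) (J := j + 1) (by omega) (by omega)
  refine ⟨u, fun j => ⟨hu1 j, hu2 j⟩, ?_⟩
  have hu0 : ∀ j, 0 < u j := fun j => lt_of_lt_of_le (by positivity) (hu1 j)
  set φ : Fin k → ℝ := fun j => (((j : ℕ) + 1) * Real.pi - u j) / k with hφ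
  have hφk : ∀ j, k * φ j = ((j : ℕ) + 1) * Real.pi - u j := fun j => by
    simp only [hφ]; field_simp
  have hφ0 : ∀ j, 0 < φ j := fun j => by
    have : (0 : ℝ) ≤ (j : ℕ) := by positivity
    have := hu2 j
    have : 0 < k * φ j := by rw [hφk]; nlinarith
    exact pos_of_mul_pos_right this (by linarith)
  have hφπ : ∀ j, φ j < Real.pi := fun j => by
    have : ((j : ℕ) : ℝ) + 1 ≤ k := by exact_mod_cast j.2
    have h1 := hu0 j
    have h2 := hφk j
    have : k * φ j < k * Real.pi := by nlinarith
    exact lt_of_mul_lt_mul_left this (by linarith)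
  -- Each `k * φ j` lies in `[(j + 1/2)π, (j + 1)π)`, so the `k` pairs of zeros are distinct and
  -- exhaust the degree `2k`.
  have hinj : ∀ i j : Fin k, i ≠ j → Real.cos (φ i) ≠ Real.cos (φ j) := by
    intro i j hij h
    have h1 := Real.injOn_cos ⟨(hφ0 i).le, (hφπ i).le⟩ ⟨(hφ0 j).le, (hφπ j).le⟩ h
    have h2 := hφk i
    rw [h1, hφk j] at h2
    have hi := hu0 i
    have hi' := hu2 i
    have hj := hu0 j
    have hj' := hu2 j
    rcases lt_or_gt_of_ne (fun h => hij (Fin.ext h) : (i : ℕ) ≠ j) with h | h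
    · have : ((i : ℕ) : ℝ) + 1 ≤ (j : ℕ) := by exact_mod_cast h
      nlinarith
    · have : ((j : ℕ) : ℝ) + 1 ≤ (i : ℕ) := by exact_mod_cast h
      nlinarith
  refine eq_of_monic_of_dvd_of_natDegree_le (cosPoly_monic _) (halfPoly_monic hk) ?_ ?_
  · refine Finset.prod_dvd_of_coprime ?_ ?_
    · intro i _ j _ hij
      exact isCoprime_quadratic fun h => hinj i j hij (by linarith)
    · intro j _
      have him : (Complex.exp (φ j * Complex.I)).im = Real.sin (φ j) :=
        Complex.exp_ofReal_mul_I_im _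
      have hre : (Complex.exp (φ j * Complex.I)).re = Real.cos (φ j) :=
        Complex.exp_ofReal_mul_I_re _
      have hsin : Real.sin (φ j) ≠ 0 := (Real.sin_pos_of_pos_of_lt_pi (hφ0 j) (hφπ j)).ne'
      have h0 : aeval (Complex.exp (φ j * Complex.I)) (halfPoly k) = 0 := by
        have h := coe_aeval_halfPoly_exp hk (φ j)
        have hG : 3 * Real.cos (k * φ j) * Real.sin (φ j / 2) +
            Real.sin (k * φ j) * Real.cos (φ j / 2) = 0 := by
          have h3 := hu3 j
          push_cast at h3
          have e : ((j : ℕ) + 1) * Real.pi = ((j + 1 : ℕ) : ℝ) * Real.pi := by push_cast; rfl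
          rw [hφk, e, Real.cos_sub, Real.sin_sub, Real.sin_nat_mul_pi, Real.cos_nat_mul_pi]
          linear_combination (-1 : ℝ) ^ ((j : ℕ) + 1) * h3
        rw [hG, Complex.ofReal_zero, mul_zero] at h
        refine (mul_eq_zero.1 h).resolve_left fun h1 => hsin ?_
        rw [← him, sub_eq_zero.1 h1, Complex.one_im]
      have h := quadratic_dvd_of_aeval_eq_zero_im_ne_zero (halfPoly k) h0 (by rwa [him])
      rw [hre, Complex.norm_exp_ofReal_mul_I] at h
      simpa using h
  · rw [cosPoly_natDegree, Fintype.card_fin]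
    exact halfPoly_natDegree_le k

end UnitCirclePolynomials

/-! ### Effect of moving the zeros on the values at roots of unity. -/

section Perturbation

open Polynomial

/-- In the product formula for `cos α - cos φ`, one sine is at least `sin φ / 2` and the other obeys
Jordan's inequality. -/
lemma sin_mul_abs_sub_le {α φ : ℝ} (hα : 0 ≤ α) (hα' : α ≤ Real.pi) (hφ : 0 ≤ φ)
    (hφ' : φ ≤ Real.pi) :
    Real.sin φ * |α - φ| ≤ Real.pi * |Real.cos α - Real.cos φ| := by
  have hpi := Real.pi_pos
  have hmid : 0 ≤ Real.sin ((α + φ) / 2) :=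
    Real.sin_nonneg_of_nonneg_of_le_pi (by linarith) (by linarith)
  have h1 : Real.sin φ ≤ 2 * Real.sin ((α + φ) / 2) := by
    have h2 : Real.sin α + Real.sin φ =
        2 * Real.sin ((α + φ) / 2) * Real.cos ((α - φ) / 2) := by
      have e1 : Real.sin α = Real.sin ((α + φ) / 2 + (α - φ) / 2) := by congr 1; ring
      have e2 : Real.sin φ = Real.sin ((α + φ) / 2 - (α - φ) / 2) := by congr 1; ring
      rw [e1, e2, Real.sin_add, Real.sin_sub]; ring
    have h3 := Real.cos_le_one ((α - φ) / 2)
    have h4 := Real.sin_nonneg_of_nonneg_of_le_pi hα hα'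
    nlinarith
  have h5 : |α - φ| ≤ Real.pi * |Real.sin ((α - φ) / 2)| := by
    have := Real.mul_abs_le_abs_sin (x := (α - φ) / 2)
      (by rw [abs_le]; constructor <;> linarith)
    rw [abs_div, abs_two] at this
    have h6 : Real.pi * (2 / Real.pi * (|α - φ| / 2)) = |α - φ| := by field_simp
    rw [← h6]
    gcongr
  rw [Real.cos_sub_cos, abs_mul, abs_mul, abs_neg, abs_two, abs_of_nonneg hmid]
  calc _ ≤ 2 * Real.sin ((α + φ) / 2) * (Real.pi * |Real.sin ((α - φ) / 2)|) := by gcongr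
    _ = _ := by ring

/-- Keeping the factor `sin φ` matters near `0` and `π`: it cancels against the one in
`sin_mul_abs_sub_le`. -/
lemma abs_cos_sub_cos_le (φ ψ : ℝ) :
    |Real.cos φ - Real.cos ψ| ≤ |ψ - φ| * (|Real.sin φ| + |ψ - φ| / 2) := by
  have h2 : |Real.sin ((φ - ψ) / 2)| ≤ |ψ - φ| / 2 := by
    refine (Real.abs_sin_le_abs).trans_eq ?_
    rw [abs_div, abs_two, abs_sub_comm]
  have h3 : |Real.sin ((φ + ψ) / 2)| ≤ |Real.sin φ| + |ψ - φ| / 2 := by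
    have h4 : Real.sin ((φ + ψ) / 2) = Real.sin φ * Real.cos ((ψ - φ) / 2) +
        Real.cos φ * Real.sin ((ψ - φ) / 2) := by
      rw [← Real.sin_add]; congr 1; ring
    rw [h4]
    refine (abs_add_le _ _).trans ?_
    rw [abs_mul, abs_mul]
    have h5 := Real.abs_cos_le_one ((ψ - φ) / 2)
    have h6 := Real.abs_cos_le_one φ
    have h7 : |Real.sin ((ψ - φ) / 2)| ≤ |ψ - φ| / 2 := by
      refine (Real.abs_sin_le_abs).trans_eq ?_
      rw [abs_div, abs_two]
    have h8 := abs_nonneg (Real.sin φ)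
    have h9 := abs_nonneg (Real.sin ((ψ - φ) / 2))
    nlinarith
  rw [Real.cos_sub_cos, abs_mul, abs_mul, abs_neg, abs_two]
  calc _ ≤ 2 * (|Real.sin φ| + |ψ - φ| / 2) * (|ψ - φ| / 2) := by gcongr
    _ = _ := by ring

lemma mul_min_le_sin {φ : ℝ} (h0 : 0 ≤ φ) (h1 : φ ≤ Real.pi) :
    2 / Real.pi * min φ (Real.pi - φ) ≤ Real.sin φ := by
  have hpi := Real.pi_pos
  rcases le_total φ (Real.pi / 2) with h | h
  · rw [min_eq_left (by linarith)]
    exact Real.mul_le_sin h0 h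
  · rw [min_eq_right (by linarith), ← Real.sin_pi_sub]
    exact Real.mul_le_sin (by linarith) (by linarith)

lemma angle_bounds {k J : ℕ} (hJ : 1 ≤ J) (hJk : J ≤ k) {u : ℝ} (hu : Real.pi / (3 * k) ≤ u)
    (hu' : u ≤ Real.pi / 2) :
    Real.pi / (3 * k ^ 2) ≤ (J * Real.pi - u) / k ∧
      (J * Real.pi - u) / k ≤ Real.pi - Real.pi / (3 * k ^ 2) := by
  have hk1 : (1 : ℝ) ≤ k := by exact_mod_cast hJ.trans hJk
  have hJ1 : (1 : ℝ) ≤ J := by exact_mod_cast hJ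
  have hJk' : (J : ℝ) ≤ k := by exact_mod_cast hJk
  have hpi := Real.pi_pos
  have e : Real.pi / (3 * k ^ 2) = Real.pi / (3 * k) / k := by field_simp
  have h3 : Real.pi / (3 * k) ≤ Real.pi / 2 := hu.trans hu'
  constructor
  · rw [e]; gcongr; nlinarith
  · rw [e, div_le_iff₀ (by linarith), sub_mul, div_mul_cancel₀ _ (by linarith)]
    nlinarith

/-- Relative effect of an angular perturbation of size `π / (70 (k+1)²)` on one factor. -/
lemma abs_cos_sub_cos_le_ratio {k J l : ℕ} (hJ : 1 ≤ J) (hJk : J ≤ k) (hl : l ≤ k) {u ψ : ℝ}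
    (hu : Real.pi / (3 * k) ≤ u) (hu' : u ≤ Real.pi / 2)
    (hψ : |ψ - (J * Real.pi - u) / k| ≤ Real.pi / (70 * (k + 1) ^ 2)) :
    |Real.cos ((J * Real.pi - u) / k) - Real.cos ψ| ≤
      0.0472 / k * (1 + (if J = l then 3 * (k : ℝ) - 1 else 0) + (if J = l + 1 then 1 else 0)) *
      |Real.cos (l * Real.pi / k) - Real.cos ((J * Real.pi - u) / k)| := by
  have hk1 : (1 : ℝ) ≤ k := by exact_mod_cast hJ.trans hJk
  have hlk' : (l : ℝ) ≤ k := by exact_mod_cast hl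
  have hpi := Real.pi_pos
  have hpi3 := Real.pi_gt_three
  have hpi4 := Real.pi_lt_d2
  obtain ⟨hφ0, hφ1⟩ := angle_bounds hJ hJk hu hu'
  set φ := (J * Real.pi - u) / k with hφ
  set α := l * Real.pi / k with hα
  have hkφ : k * φ = J * Real.pi - u := by rw [hφ]; field_simp
  have hkα : k * α = l * Real.pi := by rw [hα]; field_simp
  have hα0 : 0 ≤ α := by positivity
  have hα1 : α ≤ Real.pi := by
    rw [hα, div_le_iff₀ (by linarith)]; nlinarith
  have hc : 0 < Real.pi / (3 * k ^ 2) := by positivity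
  have hsin : 2 / (3 * k ^ 2) ≤ Real.sin φ := by
    refine le_trans ?_ (mul_min_le_sin (by linarith) (by linarith))
    have : Real.pi / (3 * k ^ 2) ≤ min φ (Real.pi - φ) := le_min hφ0 (by linarith)
    calc _ = 2 / Real.pi * (Real.pi / (3 * k ^ 2)) := by field_simp
      _ ≤ _ := by gcongr
  have hsin0 : 0 < Real.sin φ := lt_of_lt_of_le (by positivity) hsin
  set δ := Real.pi / (70 * (k + 1) ^ 2) with hδ
  have hδ0 : 0 < δ := by positivity
  have hδk : δ * k ^ 2 ≤ Real.pi / 70 := by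
    rw [hδ, div_mul_eq_mul_div, div_le_div_iff₀ (by positivity) (by positivity)]
    have : (k : ℝ) ^ 2 ≤ (k + 1) ^ 2 := by gcongr; linarith
    nlinarith
  have hδs : δ / 2 ≤ 0.04 * Real.sin φ := by
    refine le_trans ?_ (mul_le_mul_of_nonneg_left hsin (by norm_num))
    rw [mul_div_assoc', div_le_div_iff₀ (by norm_num) (by positivity)]
    nlinarith
  have hnum : |Real.cos φ - Real.cos ψ| ≤ 1.04 * δ * Real.sin φ := by
    refine (abs_cos_sub_cos_le _ _).trans ?_
    rw [abs_of_pos hsin0]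
    calc _ ≤ δ * (Real.sin φ + δ / 2) := by gcongr
      _ ≤ _ := by nlinarith
  -- Here `1 / w` bounds `k|α - φ| / π` from below. For `J = l` the gap `k|α - φ|` is `u ≥ π/(3k)`,
  -- so `w = 3k`; for `J = l + 1` it is `π - u ≥ π/2`, so `w = 2`; otherwise it is at least `π`.
  set w : ℝ := 1 + (if J = l then 3 * (k : ℝ) - 1 else 0) + (if J = l + 1 then 1 else 0) with hw
  have hw0 : 0 ≤ w := by
    rw [hw]; split_ifs <;> linarith
  have hgap : Real.pi ≤ k * w * |α - φ| := by
    have e1 : k * w * |α - φ| = w * |l * Real.pi - (J * Real.pi - u)| := by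
      rw [← hkα, ← hkφ, ← mul_sub, abs_mul, abs_of_pos (by linarith : (0 : ℝ) < k)]; ring
    rw [e1]
    have hu3 : Real.pi ≤ 3 * k * u := by
      rw [div_le_iff₀ (by positivity)] at hu; linarith
    have hu0 : 0 < u := lt_of_lt_of_le (by positivity) hu
    clear_value w
    clear hsin hsin0 hδ0 hδk hδs hnum hφ0 hφ1 hψ hα0 hα1 hc
    rcases lt_trichotomy J l with h | h | h
    · have h1 : (J : ℝ) + 1 ≤ l := by exact_mod_cast h
      have h2 : ((J : ℝ) + 1) * Real.pi ≤ l * Real.pi := by gcongr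
      rw [if_neg h.ne, if_neg (by omega)] at hw
      rw [hw, abs_of_nonneg (by linarith)]; linarith
    · subst h
      rw [if_pos rfl, if_neg (by omega)] at hw
      rw [hw, abs_of_nonneg (by linarith)]
      linarith
    · by_cases h2 : J = l + 1
      · rw [if_neg h.ne', if_pos h2] at hw
        rw [hw, h2]
        push_cast
        rw [abs_of_nonpos (by linarith)]; linarith
      · have h1 : (l : ℝ) + 2 ≤ J := by exact_mod_cast (show l + 2 ≤ J by omega)
        have h3 : ((l : ℝ) + 2) * Real.pi ≤ J * Real.pi := by gcongr
        rw [if_neg h.ne', if_neg h2] at hw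
        rw [hw, abs_of_nonpos (by linarith)]; linarith
  have hs := sin_mul_abs_sub_le hα0 hα1 (by linarith) (by linarith : φ ≤ Real.pi)
  have h1 : Real.sin φ ≤ k * w * |Real.cos α - Real.cos φ| := by
    have h2 : Real.pi * Real.sin φ ≤ Real.pi * (k * w * |Real.cos α - Real.cos φ|) :=
      calc _ ≤ k * w * |α - φ| * Real.sin φ := by gcongr
        _ = k * w * (Real.sin φ * |α - φ|) := by ring
        _ ≤ k * w * (Real.pi * |Real.cos α - Real.cos φ|) := by gcongr
        _ = _ := by ring
    exact le_of_mul_le_mul_left h2 hpi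
  -- The constant comes from `1.04 * π / 70 < 0.0472`, using `π < 3.15`.
  calc _ ≤ 1.04 * δ * Real.sin φ := hnum
    _ ≤ 1.04 * δ * (k * w * |Real.cos α - Real.cos φ|) := by gcongr
    _ = 1.04 * (δ * k ^ 2) / k * w * |Real.cos α - Real.cos φ| := by
        field_simp
    _ ≤ _ := by gcongr; linarith

/-- Relative effect of an angular perturbation on the values of the polynomial at the
`2k`-th roots of unity in the upper half plane. -/
lemma abs_prod_sub_prod_le {k l : ℕ} (hk : 1 ≤ k) (hl : l ≤ k) {u ψ : Fin k → ℝ}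
    (hu : ∀ j, Real.pi / (3 * k) ≤ u j ∧ u j ≤ Real.pi / 2)
    (hψ : ∀ j : Fin k, |ψ j - (((j : ℕ) + 1) * Real.pi - u j) / k| ≤
      Real.pi / (70 * (k + 1) ^ 2)) :
    |∏ j, (2 * Real.cos (l * Real.pi / k) - 2 * Real.cos (ψ j)) -
      ∏ j : Fin k, (2 * Real.cos (l * Real.pi / k) -
        2 * Real.cos ((((j : ℕ) + 1) * Real.pi - u j) / k))| ≤
      0.235 * |∏ j : Fin k, (2 * Real.cos (l * Real.pi / k) -
        2 * Real.cos ((((j : ℕ) + 1) * Real.pi - u j) / k))| := by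
  have hk1 : (1 : ℝ) ≤ k := by exact_mod_cast hk
  set α := l * Real.pi / k with hα
  set φ : Fin k → ℝ := fun j => (((j : ℕ) + 1) * Real.pi - u j) / k with hφ
  set w : Fin k → ℝ := fun j => 1 + (if (j : ℕ) + 1 = l then 3 * (k : ℝ) - 1 else 0) +
    (if (j : ℕ) = l then 1 else 0) with hw
  have hb : ∀ j, |Real.cos (φ j) - Real.cos (ψ j)| ≤
      0.0472 / k * w j * |Real.cos α - Real.cos (φ j)| := by
    intro j
    have h := abs_cos_sub_cos_le_ratio (J := j + 1) (by omega) (by omega) hl (hu j).1 (hu j).2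
      (ψ := ψ j) (by push_cast; exact hψ j)
    push_cast at h
    simpa only [Nat.add_right_cancel_iff] using h
  by_cases hz : ∃ j, Real.cos α = Real.cos (φ j)
  · obtain ⟨j, hj⟩ := hz
    have h1 : Real.cos α = Real.cos (ψ j) := by
      have := hb j
      rw [hj, sub_self, abs_zero, mul_zero] at this
      rw [hj, ← sub_eq_zero, ← abs_nonpos_iff]; exact this
    rw [Finset.prod_eq_zero (Finset.mem_univ j) (by rw [h1, sub_self]),
      Finset.prod_eq_zero (Finset.mem_univ j)
        (by change 2 * Real.cos α - 2 * Real.cos (φ j) = 0; rw [hj, sub_self])]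
    simp
  push Not at hz
  set e : Fin k → ℝ := fun j => (Real.cos (φ j) - Real.cos (ψ j)) / (Real.cos α - Real.cos (φ j))
    with he
  have hprod : ∏ j, (2 * Real.cos α - 2 * Real.cos (ψ j)) =
      (∏ j, (1 + e j)) * ∏ j, (2 * Real.cos α - 2 * Real.cos (φ j)) := by
    rw [← Finset.prod_mul_distrib]
    refine Finset.prod_congr rfl fun j _ => ?_
    have : Real.cos α - Real.cos (φ j) ≠ 0 := sub_ne_zero.2 (hz j)
    simp only [he]
    field_simp
    ring
  have hej : ∀ j, ‖e j‖ ≤ 0.0472 / k * w j := by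
    intro j
    have : 0 < |Real.cos α - Real.cos (φ j)| := abs_pos.2 (sub_ne_zero.2 (hz j))
    rw [Real.norm_eq_abs, abs_div, div_le_iff₀ this]
    exact hb j
  -- The `k` ones, plus `3k - 1` and `1` from at most one index each.
  have hsumw : ∑ j, w j ≤ 4 * k := by
    simp only [hw, Finset.sum_add_distrib]
    have h1 : ∑ j : Fin k, (if (j : ℕ) + 1 = l then 3 * (k : ℝ) - 1 else 0) ≤ 3 * k - 1 := by
      rw [← Finset.sum_filter, Finset.sum_const, nsmul_eq_mul]
      have : (Finset.univ.filter fun j : Fin k => (j : ℕ) + 1 = l).card ≤ 1 := by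
        refine Finset.card_le_one.2 fun a ha b hb => ?_
        have ha := (Finset.mem_filter.1 ha).2
        have hb := (Finset.mem_filter.1 hb).2
        exact Fin.ext (by omega)
      have : ((Finset.univ.filter fun j : Fin k => (j : ℕ) + 1 = l).card : ℝ) ≤ 1 := by
        exact_mod_cast this
      nlinarith
    have h2 : ∑ j : Fin k, (if (j : ℕ) = l then (1 : ℝ) else 0) ≤ 1 := by
      rw [← Finset.sum_filter, Finset.sum_const, nsmul_eq_mul, mul_one]
      have : (Finset.univ.filter fun j : Fin k => (j : ℕ) = l).card ≤ 1 := by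
        refine Finset.card_le_one.2 fun a ha b hb => ?_
        have ha := (Finset.mem_filter.1 ha).2
        have hb := (Finset.mem_filter.1 hb).2
        exact Fin.ext (by omega)
      exact_mod_cast this
    simp only [Finset.sum_const, Finset.card_univ, Fintype.card_fin, nsmul_eq_mul, mul_one]
    linarith
  have hsum : ∑ j, ‖e j‖ ≤ 0.19 := by
    refine (Finset.sum_le_sum fun j _ => hej j).trans ?_
    rw [← Finset.mul_sum]
    calc _ ≤ 0.0472 / k * (4 * (k : ℝ)) := by gcongr
      _ = 0.1888 := by field_simp; norm_num
      _ ≤ _ := by norm_num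
  -- The product differs from `1` by at most `exp(∑ |e j|) - 1`.
  have hexp : ‖∏ j, (1 + e j) - 1‖ ≤ 0.235 := by
    refine (Finset.norm_prod_one_add_sub_one_le _ _).trans ?_
    have h1 := Real.exp_le_exp.2 hsum
    have h2 := Real.exp_bound_div_one_sub_of_interval (x := 0.19) (by norm_num) (by norm_num)
    have h3 : (1 / (1 - 0.19) : ℝ) ≤ 1.235 := by norm_num
    linarith
  change |∏ j, (2 * Real.cos α - 2 * Real.cos (ψ j)) -
    ∏ j, (2 * Real.cos α - 2 * Real.cos (φ j))| ≤
    0.235 * |∏ j, (2 * Real.cos α - 2 * Real.cos (φ j))|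
  rw [hprod, ← sub_one_mul, abs_mul]
  gcongr
  exact hexp

end Perturbation

/-! ### From values at roots of unity to coefficients. -/

section CoefficientBounds

open Polynomial

/-- A coefficient is at most the mean modulus of the polynomial at the `n`-th roots of unity. -/
lemma mul_abs_coeff_le_sum {n : ℕ} (hn : n ≠ 0) {R : ℝ[X]} (hR : R.natDegree < n) {i : ℕ}
    (hi : i < n) {ω : ℂ} (hω : IsPrimitiveRoot ω n) :
    n * |R.coeff i| ≤ ∑ l ∈ Finset.range n, ‖aeval (ω ^ l) R‖ := by
  have hnorm : ‖ω‖ = 1 := hω.norm'_eq_one hn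
  have hω0 : ω ≠ 0 := hω.ne_zero hn
  -- Discrete Fourier inversion; the degree being below `n` excludes aliasing.
  have hkey : ∑ l ∈ Finset.range n, aeval (ω ^ l) R * (ω ^ l)⁻¹ ^ i = n * (R.coeff i : ℂ) := by
    have h1 : ∀ l, aeval (ω ^ l) R * (ω ^ l)⁻¹ ^ i =
        ∑ m ∈ Finset.range n, (R.coeff m : ℂ) * (ω ^ m * (ω ^ i)⁻¹) ^ l := by
      intro l
      rw [aeval_eq_sum_range' hR, Finset.sum_mul]
      refine Finset.sum_congr rfl fun m _ => ?_
      rw [Algebra.smul_def, Complex.coe_algebraMap, mul_assoc, mul_pow, inv_pow, inv_pow,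
        ← pow_mul, ← pow_mul, ← pow_mul, ← pow_mul, mul_comm l m, mul_comm l i]
    simp_rw [h1]
    rw [Finset.sum_comm, Finset.sum_eq_single i]
    · rw [mul_inv_cancel₀ (pow_ne_zero _ hω0)]
      simp [mul_comm]
    · intro m hm hmi
      rw [← Finset.mul_sum]
      have hm := Finset.mem_range.1 hm
      have hne : ω ^ m * (ω ^ i)⁻¹ ≠ 1 := by
        intro h
        rw [mul_inv_eq_one₀ (pow_ne_zero _ hω0)] at h
        exact hmi (hω.pow_inj hm hi h)
      rw [geom_sum_eq hne, mul_pow, inv_pow, ← pow_mul, ← pow_mul, mul_comm m, mul_comm i, pow_mul,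
        pow_mul, hω.pow_eq_one]
      simp
    · intro h; exact absurd (Finset.mem_range.2 hi) h
  calc n * |R.coeff i| = ‖∑ l ∈ Finset.range n, aeval (ω ^ l) R * (ω ^ l)⁻¹ ^ i‖ := by
        rw [hkey, norm_mul, Complex.norm_natCast, Complex.norm_real, Real.norm_eq_abs]
    _ ≤ _ := by
      refine (norm_sum_le _ _).trans (Finset.sum_le_sum fun l _ => ?_)
      rw [norm_mul, norm_pow, norm_inv, norm_pow, hnorm]
      simp

/-- There is a product of arcs of length `π / (35 (k+1)²)` on which the inner coefficients of the
associated reciprocal polynomial stay well inside `(0, 1)`. -/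
theorem exists_angles_coeff_mem {k : ℕ} (hk : 1 ≤ k) :
    ∃ φ : Fin k → ℝ,
      (∀ j, Real.pi / (3 * k ^ 2) ≤ φ j ∧ φ j ≤ Real.pi - Real.pi / (3 * k ^ 2)) ∧
      ∀ ψ : Fin k → ℝ, (∀ j, |ψ j - φ j| ≤ Real.pi / (70 * (k + 1) ^ 2)) →
        ∀ i, 1 ≤ i → i < 2 * k →
          1 / 40 ≤ (cosPoly ψ).coeff i ∧ (cosPoly ψ).coeff i ≤ 39 / 40 := by
  obtain ⟨u, hu, hfac⟩ := exists_halfPoly_eq_cosPoly hk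
  refine ⟨fun j => (((j : ℕ) + 1) * Real.pi - u j) / k, fun j => ?_, fun ψ hψ i hi1 hi2 => ?_⟩
  · have := angle_bounds (k := k) (J := j + 1) (by omega) (by omega) (hu j).1 (hu j).2
    push_cast at this
    exact this
  have hk0 : (k : ℂ) ≠ 0 := by exact_mod_cast (show k ≠ 0 by omega)
  have hk0' : (k : ℝ) ≠ 0 := by exact_mod_cast (show k ≠ 0 by omega)
  set φ : Fin k → ℝ := fun j => (((j : ℕ) + 1) * Real.pi - u j) / k with hφ
  set ω := Complex.exp (2 * Real.pi * Complex.I / (2 * k : ℕ)) with hωdef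
  have hω : IsPrimitiveRoot ω (2 * k) := Complex.isPrimitiveRoot_exp _ (by omega)
  have hωl : ∀ l : ℕ, ω ^ l = Complex.exp (((l * Real.pi / k : ℝ) : ℂ) * Complex.I) := by
    intro l
    rw [hωdef, ← Complex.exp_nat_mul]
    congr 1
    push_cast
    field_simp
  have hval : ∀ (l : ℕ) (ψ : Fin k → ℝ), aeval (ω ^ l) (cosPoly ψ) =
      (ω ^ l) ^ k * ((∏ j, (2 * Real.cos (l * Real.pi / k) - 2 * Real.cos (ψ j)) : ℝ) : ℂ) := by
    intro l ψ
    rw [hωl, aeval_cosPoly, Fintype.card_fin]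
  have hnorm : ∀ l : ℕ, ‖(ω ^ l) ^ k‖ = 1 := by
    intro l
    rw [norm_pow, norm_pow, hω.norm'_eq_one (by omega), one_pow, one_pow]
  set R := cosPoly ψ - halfPoly k with hR
  -- Both polynomials are monic of degree `2k`, so their leading terms cancel and the `2k`-th roots
  -- of unity suffice for `R`.
  have hdeg : R.natDegree < 2 * k := by
    have h1 := cosPoly_monic ψ
    have h2 := halfPoly_monic hk
    have hd1 : (cosPoly ψ).natDegree = 2 * k := by rw [cosPoly_natDegree, Fintype.card_fin]
    have hd2 : (halfPoly k).natDegree = 2 * k := by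
      rw [hfac, cosPoly_natDegree, Fintype.card_fin]
    rw [hR]
    by_cases h0 : R = 0
    · rw [← hR, h0, natDegree_zero]; omega
    rw [← hR, natDegree_lt_iff_degree_lt h0]
    have h3 := degree_sub_lt_left (p := cosPoly ψ) (q := halfPoly k)
      (by rw [degree_eq_natDegree h1.ne_zero, degree_eq_natDegree h2.ne_zero, hd1, hd2])
      h1.ne_zero (by rw [h1.leadingCoeff, h2.leadingCoeff])
    rwa [degree_eq_natDegree h1.ne_zero, hd1] at h3
  have hbound : ∀ l ∈ Finset.range (2 * k),
      ‖aeval (ω ^ l) R‖ ≤ 0.235 * ‖aeval (ω ^ l) (halfPoly k)‖ := by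
    intro l hl
    have hl := Finset.mem_range.1 hl
    -- Roots of unity in the lower half plane are reflected to the upper one.
    obtain ⟨l', hl', hcos⟩ : ∃ l' : ℕ, l' ≤ k ∧
        Real.cos (l * Real.pi / k) = Real.cos (l' * Real.pi / k) := by
      rcases le_total l k with h | h
      · exact ⟨l, h, rfl⟩
      · refine ⟨2 * k - l, by omega, ?_⟩
        rw [← Real.cos_two_pi_sub]
        congr 1
        rw [Nat.cast_sub hl.le]
        push_cast
        field_simp
    have h := abs_prod_sub_prod_le hk hl' hu hψ
    rw [← hcos] at h
    rw [hR, map_sub, hfac, hval, hval, ← mul_sub, norm_mul, norm_mul, hnorm, one_mul, one_mul,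
      ← Complex.ofReal_sub, Complex.norm_real, Complex.norm_real]
    exact h
  -- The value is `3/2` at each of the `2k - 1` nontrivial roots and `k + 3/2` at `1`. The
  -- coefficient error is therefore at most `0.235 * 4k / 2k = 0.47`.
  have hsum : ∑ l ∈ Finset.range (2 * k), ‖aeval (ω ^ l) (halfPoly k)‖ = 4 * k := by
    obtain ⟨n, hn⟩ := Nat.exists_eq_add_of_le' (show 1 ≤ 2 * k by omega)
    rw [hn, Finset.sum_range_succ', pow_zero, aeval_one_halfPoly hk]
    have h1 : ∀ l ∈ Finset.range n, ‖aeval (ω ^ (l + 1)) (halfPoly k)‖ = 3 / 2 := by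
      intro l hl
      have hl := Finset.mem_range.1 hl
      rw [aeval_halfPoly_of_pow_eq_one hk]
      · norm_num
      · rw [← pow_mul, mul_comm, pow_mul, hω.pow_eq_one, one_pow]
      · exact hω.pow_ne_one_of_pos_of_lt (by omega) (by omega)
    rw [Finset.sum_congr rfl h1, Finset.sum_const, Finset.card_range, nsmul_eq_mul]
    have h2 : ‖(k : ℂ) + 3 / 2‖ = k + 3 / 2 := by
      have : (k : ℂ) + 3 / 2 = ((k + 3 / 2 : ℝ) : ℂ) := by push_cast; rfl
      rw [this, Complex.norm_real, Real.norm_of_nonneg (by positivity)]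
    have h3 : (n : ℝ) + 1 = 2 * k := by exact_mod_cast hn.symm
    rw [h2]
    linarith
  have hmain := mul_abs_coeff_le_sum (by omega) hdeg hi2 hω
  have h4 := hmain.trans (Finset.sum_le_sum hbound)
  rw [← Finset.mul_sum, hsum, hR, coeff_sub, halfPoly_coeff hi1 hi2] at h4
  push_cast at h4
  have hkpos : (0 : ℝ) < k := by exact_mod_cast hk
  have h5 : |(cosPoly ψ).coeff i - 1 / 2| ≤ 0.47 := by
    have : (2 * k : ℝ) * |(cosPoly ψ).coeff i - 1 / 2| ≤ (2 * k) * 0.47 := by linarith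
    exact le_of_mul_le_mul_left this (by positivity)
  rw [abs_le] at h5
  constructor <;> linarith [h5.1, h5.2]

end CoefficientBounds

/-! ### Transport of relations between conjugates. -/

section Conjugates

open scoped IntermediateField

variable {K C : Type*} [Field K] [Field C] [Algebra K C] [IsAlgClosed C]

/-- Conjugate algebraic elements are exchanged by an embedding of the algebraic closure. -/
lemma exists_embedding_of_isConjRoot {z w : C} (hz : IsIntegral K z) (h : IsConjRoot K z w) :
    ∃ τ : algebraicClosure K C →+* C, (∀ x : algebraicClosure K C, (x : C) = z → τ x = w) ∧
      ∀ x : algebraicClosure K C, IsConjRoot K (x : C) (τ x) := by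
  have hz' : z ∈ algebraicClosure K C := mem_algebraicClosure_iff.2 hz.isAlgebraic
  have hw' : w ∈ algebraicClosure K C :=
    mem_algebraicClosure_iff.2 (h.isIntegral hz).isAlgebraic
  have h' : IsConjRoot K (⟨w, hw'⟩ : algebraicClosure K C) ⟨z, hz'⟩ := by
    rw [← isConjRoot_algHom_iff (algebraicClosure K C).val]
    exact h.symm
  obtain ⟨σ, hσ⟩ := h'.exists_algEquiv
  refine ⟨((algebraicClosure K C).val.comp σ.toAlgHom).toRingHom, fun x hx => ?_, fun x => ?_⟩
  · have : x = ⟨z, hz'⟩ := Subtype.ext hx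
    rw [this]
    change ((σ ⟨z, hz'⟩ : algebraicClosure K C) : C) = w
    rw [hσ]
  · exact (isConjRoot_algHom_iff (algebraicClosure K C).val).2 (isConjRoot_of_algEquiv x σ)

lemma IsConjRoot.inv_inv {z w : C} (hz : IsIntegral K z) (h : IsConjRoot K z w) :
    IsConjRoot K z⁻¹ w⁻¹ := by
  obtain ⟨τ, hτ, hc⟩ := exists_embedding_of_isConjRoot hz h
  have hz' : z ∈ algebraicClosure K C := mem_algebraicClosure_iff.2 hz.isAlgebraic
  have := hc (⟨z, hz'⟩ : algebraicClosure K C)⁻¹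
  rw [map_inv₀, hτ _ rfl] at this
  exact this

lemma IsConjRoot.pow_pow {z w : C} (hz : IsIntegral K z) (h : IsConjRoot K z w) (m : ℕ) :
    IsConjRoot K (z ^ m) (w ^ m) := by
  obtain ⟨τ, hτ, hc⟩ := exists_embedding_of_isConjRoot hz h
  have hz' : z ∈ algebraicClosure K C := mem_algebraicClosure_iff.2 hz.isAlgebraic
  have := hc ((⟨z, hz'⟩ : algebraicClosure K C) ^ m)
  rw [map_pow, hτ _ rfl] at this
  exact this

/-- Transport of a multiplicative relation along a conjugation. -/
lemma exists_conj_map {z w : C} (hz : IsIntegral K z) (h : IsConjRoot K z w) :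
    ∃ f : C → C, f z = w ∧
      (∀ x, IsIntegral K x → IsConjRoot K x (f x)) ∧
      (∀ x y, IsIntegral K x → IsIntegral K y → f x = f y → x = y) ∧
      (∀ x, IsIntegral K x → f x⁻¹ = (f x)⁻¹) ∧
      (∀ x (m : ℕ), IsIntegral K x → f (x ^ m) = f x ^ m) ∧
      ∀ (Z : Finset C) (n : C → ℤ), (∀ x ∈ Z, IsIntegral K x) → ∏ x ∈ Z, x ^ n x = 1 →
        ∏ x ∈ Z, f x ^ n x = 1 := by
  classical
  obtain ⟨τ, hτ, hc⟩ := exists_embedding_of_isConjRoot hz h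
  have hmem : ∀ {x : C}, IsIntegral K x → x ∈ algebraicClosure K C := fun hx =>
    mem_algebraicClosure_iff.2 hx.isAlgebraic
  -- The value `0` off the algebraic closure is a dummy; all the properties claimed concern integral
  -- elements.
  let f : C → C := fun x => if hx : x ∈ algebraicClosure K C then τ ⟨x, hx⟩ else 0
  have hf : ∀ x : algebraicClosure K C, f x = τ x := fun x => dif_pos x.2
  have hf' : ∀ {x : C} (hx : IsIntegral K x), f x = τ ⟨x, hmem hx⟩ := fun hx => dif_pos _
  refine ⟨f, ?_, fun x hx => ?_, fun x y hx hy hxy => ?_, fun x hx => ?_, fun x m hx => ?_,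
    fun Z n hZ hprod => ?_⟩
  · rw [hf' hz]; exact hτ _ rfl
  · rw [hf' hx]; exact hc ⟨x, hmem hx⟩
  · rw [hf' hx, hf' hy] at hxy
    exact congrArg Subtype.val (τ.injective hxy)
  · have := hf (⟨x, hmem hx⟩ : algebraicClosure K C)⁻¹
    rw [map_inv₀] at this
    rw [hf' hx]; exact this
  · have := hf ((⟨x, hmem hx⟩ : algebraicClosure K C) ^ m)
    rw [map_pow] at this
    rw [hf' hx]; exact this
  · let g : C → algebraicClosure K C := fun x =>
      if hx : x ∈ algebraicClosure K C then ⟨x, hx⟩ else 0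
    have hg : ∀ x ∈ Z, (g x : C) = x := fun x hx => by
      simp only [g, dif_pos (hmem (hZ x hx))]
    have h1 : ∏ x ∈ Z, g x ^ n x = 1 := by
      apply Subtype.ext
      change (algebraicClosure K C).val (∏ x ∈ Z, g x ^ n x) = 1
      rw [map_prod, ← hprod]
      refine Finset.prod_congr rfl fun x hx => ?_
      rw [map_zpow₀]
      change (g x : C) ^ n x = _
      rw [hg x hx]
    have h2 := congrArg τ h1
    rw [map_prod, map_one] at h2
    rw [← h2]
    refine Finset.prod_congr rfl fun x hx => ?_
    rw [map_zpow₀, ← hf, hg x hx]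

omit [IsAlgClosed C] in
lemma minpoly_pow_natDegree_le {x : C} (hx : IsIntegral K x) (m : ℕ) :
    (minpoly K (x ^ m)).natDegree ≤ (minpoly K x).natDegree := by
  have hfin := IntermediateField.adjoin.finiteDimensional hx
  rw [← IntermediateField.adjoin.finrank hx]
  have h := minpoly.natDegree_le (A := K) ((IntermediateField.AdjoinSimple.gen K x) ^ m)
  rwa [← minpoly.algebraMap_eq (algebraMap K⟮x⟯ C).injective, map_pow,
    IntermediateField.AdjoinSimple.algebraMap_gen] at h

end Conjugates

/-! ### Conjugates of a Salem number and of its powers. -/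

lemma IsConjRoot.conj {z w : ℂ} (h : IsConjRoot ℚ z w) :
    IsConjRoot ℚ z (starRingEnd ℂ w) :=
  h.trans (isConjRoot_of_algEquiv w (Complex.conjAe.restrictScalars ℚ))

namespace IsSalemNumber

open Polynomial

variable {β : ℝ} (hβ : IsSalemNumber β)

include hβ

lemma isIntegral_int : IsIntegral ℤ (β : ℂ) :=
  hβ.isIntegral.map (Complex.ofRealHom.toIntAlgHom)

lemma isIntegral_rat : IsIntegral ℚ (β : ℂ) := hβ.isIntegral_int.tower_top

lemma isIntegral_of_isConjRoot {z : ℂ} (hz : IsConjRoot ℚ (β : ℂ) z) : IsIntegral ℚ z :=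
  hz.isIntegral hβ.isIntegral_rat

lemma ne_zero_of_isConjRoot {z : ℂ} (hz : IsConjRoot ℚ (β : ℂ) z) : z ≠ 0 :=
  hz.ne_zero (by have := hβ.one_lt; exact_mod_cast (by linarith : β ≠ 0))

/-- A conjugate `z` on the unit circle has `z⁻¹` as its complex conjugate, so `z` and `z⁻¹` are
conjugate; transport this to `β`. -/
lemma isConjRoot_inv : IsConjRoot ℚ (β : ℂ) (β : ℂ)⁻¹ := by
  obtain ⟨z, hz, hz1⟩ := hβ.exists_norm_eq_one
  have h1 := hz.conj
  rw [← Complex.inv_eq_conj hz1] at h1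
  exact h1.trans (hz.symm.inv_inv (hβ.isIntegral_of_isConjRoot hz))

/-- Both `z` and `z⁻¹` are conjugates of `β` other than `β`, so both have modulus at most one. -/
lemma norm_eq_one {z : ℂ} (hz : IsConjRoot ℚ (β : ℂ) z) (h1 : z ≠ β) (h2 : z ≠ (β : ℂ)⁻¹) :
    ‖z‖ = 1 := by
  refine le_antisymm (hβ.norm_le_one z hz h1) ?_
  have h3 : IsConjRoot ℚ (β : ℂ) z⁻¹ := hβ.isConjRoot_inv.trans (hz.inv_inv hβ.isIntegral_rat)
  have h4 := hβ.norm_le_one _ h3 fun h => h2 (by rw [← h, _root_.inv_inv])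
  rw [norm_inv] at h4
  exact (inv_le_one₀ (norm_pos_iff.2 (hβ.ne_zero_of_isConjRoot hz))).1 h4

lemma norm_coe : ‖(β : ℂ)‖ = β := by
  have := hβ.one_lt
  rw [Complex.norm_real, Real.norm_of_nonneg (by linarith)]

/-- A real `z` would be `1` or `-1`, which is rational and conjugate only to itself. -/
lemma im_ne_zero {z : ℂ} (hz : IsConjRoot ℚ (β : ℂ) z) (h1 : ‖z‖ = 1) : z.im ≠ 0 := by
  intro him
  have hb := hβ.one_lt
  have hn := hβ.norm_coe
  have hre : z = (z.re : ℂ) := Complex.ext rfl (by simp [him])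
  rw [hre, Complex.norm_real, Real.norm_eq_abs] at h1
  rcases (abs_eq zero_le_one).1 h1 with h | h
  · have h2 : z = algebraMap ℚ ℂ 1 := by rw [hre, h]; simp
    rw [h2] at hz
    rw [hz.symm.eq_algebraMap] at hn
    simp at hn; linarith
  · have h2 : z = algebraMap ℚ ℂ (-1) := by rw [hre, h]; simp
    rw [h2] at hz
    rw [hz.symm.eq_algebraMap] at hn
    simp at hn; linarith

omit hβ in
/-- The finset of complex conjugates of `β`. -/
noncomputable def _root_.conjugates (β : ℝ) : Finset ℂ := ((minpoly ℚ (β : ℂ)).aroots ℂ).toFinset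

lemma mem_conjugates {z : ℂ} : z ∈ conjugates β ↔ IsConjRoot ℚ (β : ℂ) z := by
  rw [conjugates, Multiset.mem_toFinset, isConjRoot_iff_mem_minpoly_aroots hβ.isIntegral_rat]

lemma card_conjugates : (conjugates β).card = (minpoly ℚ (β : ℂ)).natDegree := by
  have h := card_rootSet_eq_natDegree (K := ℂ)
    (minpoly.irreducible hβ.isIntegral_rat).separable (IsAlgClosed.splits _)
  rw [← h]
  simp_rw [rootSet_def, Finset.coe_sort_coe, Fintype.card_coe]
  rfl

omit hβ in
/-- The conjugates of `β` in the open upper half plane. -/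
noncomputable def _root_.upperConjugates (β : ℝ) : Finset ℂ :=
  (conjugates β).filter fun z => 0 < z.im

lemma mem_upperConjugates {z : ℂ} :
    z ∈ upperConjugates β ↔ IsConjRoot ℚ (β : ℂ) z ∧ 0 < z.im := by
  rw [upperConjugates, Finset.mem_filter, hβ.mem_conjugates]

lemma norm_of_mem_upperConjugates {z : ℂ} (hz : z ∈ upperConjugates β) : ‖z‖ = 1 := by
  rw [hβ.mem_upperConjugates] at hz
  refine hβ.norm_eq_one hz.1 ?_ ?_
  · rintro rfl; simp at hz
  · rintro rfl
    rw [← Complex.ofReal_inv] at hz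
    simp at hz

lemma coe_ne_inv : (β : ℂ) ≠ (β : ℂ)⁻¹ := by
  have := hβ.one_lt
  intro h
  have h2 : β * β = 1 := by
    have h3 : (β : ℂ) * β = 1 := by
      nth_rewrite 2 [h]
      exact mul_inv_cancel₀ (by exact_mod_cast (by linarith : β ≠ 0))
    exact_mod_cast h3
  nlinarith

/-- The conjugates of a Salem number are `β`, `β⁻¹` and the complex pairs on the unit circle. -/
lemma conjugates_eq : conjugates β = ({(β : ℂ), (β : ℂ)⁻¹} : Finset ℂ) ∪
    (upperConjugates β ∪ (upperConjugates β).image (starRingEnd ℂ)) := by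
  ext z
  simp only [Finset.mem_union, Finset.mem_insert, Finset.mem_singleton, Finset.mem_image,
    hβ.mem_conjugates, hβ.mem_upperConjugates]
  constructor
  · intro hz
    by_cases h1 : z = β
    · exact Or.inl (Or.inl h1)
    by_cases h2 : z = (β : ℂ)⁻¹
    · exact Or.inl (Or.inr h2)
    rcases lt_or_gt_of_ne (hβ.im_ne_zero hz (hβ.norm_eq_one hz h1 h2)) with h | h
    · exact Or.inr (Or.inr ⟨starRingEnd ℂ z, ⟨hz.conj, by simpa using h⟩, by simp⟩)
    · exact Or.inr (Or.inl ⟨hz, h⟩)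
  · rintro ((rfl | rfl) | (h | ⟨w, h, rfl⟩))
    · rfl
    · exact hβ.isConjRoot_inv
    · exact h.1
    · exact h.1.conj

lemma prod_conjugates {M : Type*} [CommMonoid M] (f : ℂ → M) :
    ∏ z ∈ conjugates β, f z = f β * f (β : ℂ)⁻¹ *
      ∏ z ∈ upperConjugates β, (f z * f (starRingEnd ℂ z)) := by
  have hd1 : Disjoint (upperConjugates β) ((upperConjugates β).image (starRingEnd ℂ)) := by
    rw [Finset.disjoint_left]
    intro z hz hz'
    obtain ⟨w, hw, rfl⟩ := Finset.mem_image.1 hz'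
    have h1 := (hβ.mem_upperConjugates.1 hw).2
    have h2 := (hβ.mem_upperConjugates.1 hz).2
    rw [Complex.conj_im] at h2
    linarith
  have hd2 : Disjoint ({(β : ℂ), (β : ℂ)⁻¹} : Finset ℂ)
      (upperConjugates β ∪ (upperConjugates β).image (starRingEnd ℂ)) := by
    have him : ∀ z ∈ upperConjugates β ∪ (upperConjugates β).image (starRingEnd ℂ),
        z.im ≠ 0 := by
      intro z hz
      rcases Finset.mem_union.1 hz with h | h
      · exact (hβ.mem_upperConjugates.1 h).2.ne'
      · obtain ⟨w, hw, rfl⟩ := Finset.mem_image.1 h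
        rw [Complex.conj_im]
        exact neg_ne_zero.2 (hβ.mem_upperConjugates.1 hw).2.ne'
    rw [Finset.disjoint_left]
    intro z hz hz'
    refine him z hz' ?_
    rcases Finset.mem_insert.1 hz with rfl | hz
    · simp
    · rw [Finset.mem_singleton.1 hz, ← Complex.ofReal_inv, Complex.ofReal_im]
  rw [hβ.conjugates_eq, Finset.prod_union hd2, Finset.prod_union hd1,
    Finset.prod_pair hβ.coe_ne_inv, Finset.prod_image fun x _ y _ h => (starRingEnd ℂ).injective h,
    Finset.prod_mul_distrib]

lemma card_conjugates_eq : (conjugates β).card = 2 * (upperConjugates β).card + 2 := by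
  -- A constant function into `Multiplicative ℕ` turns the product formula into a count.
  have h := hβ.prod_conjugates fun _ => Multiplicative.ofAdd (1 : ℕ)
  rw [Finset.prod_const, Finset.prod_const] at h
  have h' := congrArg Multiplicative.toAdd h
  simp at h'
  omega

lemma upperConjugates_nonempty : (upperConjugates β).Nonempty := by
  obtain ⟨z, hz, h1⟩ := hβ.exists_norm_eq_one
  rcases lt_or_gt_of_ne (hβ.im_ne_zero hz h1) with h | h
  · exact ⟨starRingEnd ℂ z, hβ.mem_upperConjugates.2 ⟨hz.conj, by simpa using h⟩⟩
  · exact ⟨z, hβ.mem_upperConjugates.2 ⟨hz, h⟩⟩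

/-- The conjugates of a Salem number in the upper half plane are multiplicatively independent. -/
theorem eq_zero_of_prod_zpow_eq_one {n : ℂ → ℤ} (h : ∏ z ∈ upperConjugates β, z ^ n z = 1)
    {z : ℂ} (hz : z ∈ upperConjugates β) : n z = 0 := by
  classical
  have hz' := hβ.mem_upperConjugates.1 hz
  have hint : ∀ w ∈ upperConjugates β, IsIntegral ℚ w := fun w hw =>
    hβ.isIntegral_of_isConjRoot (hβ.mem_upperConjugates.1 hw).1
  -- Send `z` to `β`. Any other `w` in the upper half plane differs from `z` and from `z⁻¹`, the
  -- complex conjugate of `z`, so its image stays on the unit circle. Taking norms leaves `β ^ n z =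
  -- 1`.
  obtain ⟨f, hfz, hconj, hinj, hinv, -, hprod⟩ := exists_conj_map (hint z hz) hz'.1.symm
  have h1 := hprod (upperConjugates β) n hint h
  have h2 := congrArg norm h1
  rw [norm_prod, ← Finset.mul_prod_erase _ _ hz, hfz, Finset.prod_eq_one, mul_one, norm_one,
    norm_zpow, hβ.norm_coe] at h2
  · by_contra hn
    have := hβ.one_lt
    exact hn ((zpow_eq_one_iff_right₀ (by linarith) (by linarith)).1 h2)
  · intro w hw
    have hw := Finset.mem_erase.1 hw
    have hw' := hβ.mem_upperConjugates.1 hw.2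
    rw [norm_zpow, hβ.norm_eq_one (hw'.1.trans (hconj w (hint w hw.2))), one_zpow]
    · intro h3
      exact hw.1 (hinj _ _ (hint w hw.2) (hint z hz) (h3.trans hfz.symm))
    · intro h3
      rw [← hfz, ← hinv z (hint z hz)] at h3
      have h4 := hinj _ _ (hint w hw.2) (hint z hz).inv h3
      rw [Complex.inv_eq_conj (hβ.norm_of_mem_upperConjugates hz)] at h4
      have h5 := hw'.2
      rw [h4, Complex.conj_im] at h5
      linarith [hz'.2]

/-- If `z ^ m = w ^ m`, sending `z` to `β` sends `w` to another conjugate, of modulus at most one,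
whose `m`-th power would be `β ^ m`. -/
lemma pow_injOn_conjugates {m : ℕ} (hm : m ≠ 0) :
    Set.InjOn (fun z : ℂ => z ^ m) (conjugates β) := by
  intro z hz w hw hzw
  have hz' := hβ.mem_conjugates.1 hz
  have hw' := hβ.mem_conjugates.1 hw
  have hzi := hβ.isIntegral_of_isConjRoot hz'
  have hwi := hβ.isIntegral_of_isConjRoot hw'
  by_contra hne
  obtain ⟨f, hfz, hconj, hinj, -, hpow, -⟩ := exists_conj_map hzi hz'.symm
  have h1 : (β : ℂ) ^ m = f w ^ m := by
    rw [← hfz, ← hpow z m hzi, ← hpow w m hwi]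
    exact congrArg f hzw
  have h2 := congrArg norm h1
  rw [norm_pow, norm_pow, hβ.norm_coe] at h2
  have h3 := hβ.norm_le_one (f w) (hw'.trans (hconj w hwi)) fun h =>
    hne (hinj _ _ hzi hwi (hfz.trans h.symm))
  have h4 := one_lt_pow₀ hβ.one_lt hm
  rw [h2] at h4
  exact absurd (pow_le_one₀ (norm_nonneg _) h3) (not_le.2 h4)

lemma natDegree_minpoly_pow_le (m : ℕ) :
    (minpoly ℚ ((β : ℂ) ^ m)).natDegree ≤ (conjugates β).card := by
  rw [hβ.card_conjugates]
  exact minpoly_pow_natDegree_le hβ.isIntegral_rat m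

/-- The minimal polynomial of `β ^ m` has as its roots the `m`-th powers of the conjugates. -/
theorem minpoly_pow_map {m : ℕ} (hm : m ≠ 0) :
    (minpoly ℚ ((β : ℂ) ^ m)).map (algebraMap ℚ ℂ) =
      ∏ z ∈ conjugates β, (X - C (z ^ m)) := by
  have hmi : IsIntegral ℚ ((β : ℂ) ^ m) := hβ.isIntegral_rat.pow m
  refine eq_of_monic_of_dvd_of_natDegree_le
    (monic_prod_of_monic _ _ fun _ _ => monic_X_sub_C _) ((minpoly.monic hmi).map _) ?_ ?_
  · refine Finset.prod_dvd_of_coprime ?_ fun z hz => ?_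
    · intro z hz w hw hzw
      exact isCoprime_X_sub_C_of_isUnit_sub
        (sub_ne_zero.2 fun h => hzw (hβ.pow_injOn_conjugates hm hz hw h)).isUnit
    · rw [dvd_iff_isRoot, IsRoot.def, eval_map_algebraMap]
      exact ((hβ.mem_conjugates.1 hz).pow_pow hβ.isIntegral_rat m).aeval_eq_zero
  · rw [natDegree_map, natDegree_prod_of_monic _ _ fun _ _ => monic_X_sub_C _]
    simp only [natDegree_X_sub_C, Finset.sum_const, smul_eq_mul, mul_one]
    exact hβ.natDegree_minpoly_pow_le m

/-- The integral polynomial with roots the `m`-th powers of the conjugates of `β`. -/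
theorem exists_int_polynomial {m : ℕ} (hm : m ≠ 0) : ∃ P : ℤ[X],
    P.map (Int.castRingHom ℝ) = (X ^ 2 - C (β ^ m + (β ^ m)⁻¹) * X + 1) *
      ∏ z ∈ upperConjugates β, (X ^ 2 - C (2 * (z ^ m).re) * X + 1) := by
  have hmi : IsIntegral ℤ ((β : ℂ) ^ m) := hβ.isIntegral_int.pow m
  refine ⟨minpoly ℤ ((β : ℂ) ^ m), map_injective Complex.ofRealHom Complex.ofReal_injective ?_⟩
  have h1 := hβ.minpoly_pow_map hm
  rw [minpoly.isIntegrallyClosed_eq_field_fractions' ℚ hmi, Polynomial.map_map, hβ.prod_conjugates] at h1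
  rw [Polynomial.map_map]
  have e : Complex.ofRealHom.comp (Int.castRingHom ℝ) =
      (algebraMap ℚ ℂ).comp (algebraMap ℤ ℚ) := RingHom.ext_int _ _
  rw [e, h1, Polynomial.map_mul, Polynomial.map_prod]
  have hb : (β : ℂ) ≠ 0 := by exact_mod_cast (by linarith [hβ.one_lt] : β ≠ 0)
  congr 1
  · simp only [Polynomial.map_add, Polynomial.map_sub, Polynomial.map_mul, Polynomial.map_pow,
      map_X, Polynomial.map_one, map_C, Complex.ofRealHom_eq_coe]
    push_cast
    have h2 : (C ((β : ℂ) ^ m) : ℂ[X]) * C (((β : ℂ) ^ m)⁻¹) = 1 := by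
      rw [← C_mul, mul_inv_cancel₀ (pow_ne_zero _ hb), C_1]
    rw [inv_pow, C_add]
    linear_combination h2
  · refine Finset.prod_congr rfl fun z hz => ?_
    simp only [Polynomial.map_add, Polynomial.map_sub, Polynomial.map_mul, Polynomial.map_pow,
      map_X, Polynomial.map_one, map_C, Complex.ofRealHom_eq_coe]
    have h2 : (C (z ^ m) : ℂ[X]) * C ((starRingEnd ℂ z) ^ m) = 1 := by
      rw [← Complex.inv_eq_conj (hβ.norm_of_mem_upperConjugates hz), inv_pow, ← C_mul,
        mul_inv_cancel₀ (pow_ne_zero _ (hβ.ne_zero_of_isConjRoot (hβ.mem_upperConjugates.1 hz).1)),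
        C_1]
    have h3 : (C ((2 * (z ^ m).re : ℝ) : ℂ) : ℂ[X]) = C (z ^ m) + C ((starRingEnd ℂ z) ^ m) := by
      rw [← C_add, ← map_pow, Complex.add_conj]
    rw [h3]
    linear_combination h2

end IsSalemNumber

/-! ### Digits read off the minimal polynomial. -/

section Digits

open Polynomial

lemma quadratic_reverse (a : ℝ) : (X ^ 2 - C a * X + 1 : ℝ[X]).reverse = X ^ 2 - C a * X + 1 := by
  have h : (X ^ 2 - C a * X + 1 : ℝ[X]) = C 1 * X ^ 2 + C (-a) * X ^ 1 + C 1 * X ^ 0 := by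
    simp only [map_one, map_neg]; ring
  rw [reverse, quadratic_natDegree, h, reflect_add, reflect_add, reflect_C_mul_X_pow,
    reflect_C_mul_X_pow, reflect_C_mul_X_pow, revAt_le (by norm_num), revAt_le (by norm_num),
    revAt_le (by norm_num)]
  ring

lemma cosPoly_reverse {ι : Type*} [Fintype ι] (ψ : ι → ℝ) : (cosPoly ψ).reverse = cosPoly ψ := by
  classical
  rw [cosPoly]
  induction (Finset.univ : Finset ι) using Finset.induction_on with
  | empty => simpa using reverse_C (1 : ℝ)
  | insert a s ha ih => rw [Finset.prod_insert ha, reverse_mul_of_domain, quadratic_reverse, ih]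

lemma cosPoly_coeff_symm {k : ℕ} (ψ : Fin k → ℝ) {i : ℕ} (hi : i ≤ 2 * k) :
    (cosPoly ψ).coeff (2 * k - i) = (cosPoly ψ).coeff i := by
  conv_rhs => rw [← cosPoly_reverse]
  rw [coeff_reverse, cosPoly_natDegree, Fintype.card_fin, revAt_le hi]

lemma cosPoly_coeff_top {k : ℕ} (ψ : Fin k → ℝ) : (cosPoly ψ).coeff (2 * k) = 1 := by
  have h := (cosPoly_monic ψ).coeff_natDegree
  rwa [cosPoly_natDegree, Fintype.card_fin] at h

lemma cosPoly_coeff_zero {k : ℕ} (ψ : Fin k → ℝ) : (cosPoly ψ).coeff 0 = 1 := by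
  rw [← cosPoly_coeff_symm ψ (Nat.zero_le _), Nat.sub_zero, cosPoly_coeff_top]

lemma quadratic_mul_coeff_one (S : ℝ) (Q : ℝ[X]) :
    ((X ^ 2 - C S * X + 1) * Q).coeff 1 = Q.coeff 1 - S * Q.coeff 0 := by
  rw [add_mul, sub_mul, one_mul, coeff_add, coeff_sub, mul_assoc, coeff_C_mul, coeff_X_mul,
    coeff_X_pow_mul']
  simp
  ring

lemma quadratic_mul_coeff_add_two (S : ℝ) (Q : ℝ[X]) (j : ℕ) :
    ((X ^ 2 - C S * X + 1) * Q).coeff (j + 2) =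
      Q.coeff j - S * Q.coeff (j + 1) + Q.coeff (j + 2) := by
  rw [add_mul, sub_mul, one_mul, coeff_add, coeff_sub, mul_assoc, coeff_C_mul, coeff_X_mul,
    coeff_X_pow_mul]

/-- If the inner coefficients of the cofactor of `(X - B)(X - B⁻¹)` lie well inside `(0, 1)` and
`B` is large, then the coefficients of an integral polynomial with root `B` give the digits of the
expansion of one. -/
theorem hasOnePeriodicExpansion_of_coeff {B : ℝ} (hB : 200 ≤ B) {k : ℕ} (hk : 1 ≤ k)
    {ψ : Fin k → ℝ} {P : ℤ[X]}
    (hP : P.map (Int.castRingHom ℝ) = (X ^ 2 - C (B + B⁻¹) * X + 1) * cosPoly ψ)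
    (hψ : ∀ i, 1 ≤ i → i < 2 * k →
      1 / 40 ≤ (cosPoly ψ).coeff i ∧ (cosPoly ψ).coeff i ≤ 39 / 40) :
    HasOnePeriodicExpansion B := by
  -- After this shift `cosPoly ψ` has degree `2k + 2` and `P` has degree `2k + 4`.
  obtain ⟨k, rfl⟩ := Nat.exists_eq_add_of_le' hk
  set q : ℕ → ℝ := (cosPoly ψ).coeff with hq
  set S := B + B⁻¹ with hS
  have hB0 : 0 < B := by linarith
  have hSB : 200 ≤ S := by
    have : 0 < B⁻¹ := by positivity
    linarith
  have hcoeff : ∀ j, (P.coeff j : ℝ) = ((X ^ 2 - C S * X + 1) * cosPoly ψ).coeff j := by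
    intro j
    rw [← hP, coeff_map]; rfl
  have hq0 : q 0 = 1 := cosPoly_coeff_zero ψ
  have hqtop : q (2 * k + 2) = 1 := cosPoly_coeff_top ψ
  have hqsymm : q (2 * k + 1) = q 1 := cosPoly_coeff_symm ψ (i := 1) (by omega)
  have hqhigh : ∀ j, q (2 * k + 3 + j) = 0 := fun j =>
    coeff_eq_zero_of_natDegree_lt (by rw [cosPoly_natDegree, Fintype.card_fin]; omega)
  have hqmem : ∀ i, i ≤ 2 * k + 2 → 0 ≤ q i ∧ q i ≤ 1 := by
    intro i hi
    rcases Nat.eq_zero_or_pos i with rfl | h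
    · rw [hq0]; norm_num
    rcases hi.eq_or_lt with rfl | h'
    · rw [hqtop]; norm_num
    · have := hψ i h (by omega)
      constructor <;> linarith [this.1, this.2]
  have hc1 : (P.coeff 1 : ℝ) = q 1 - S := by
    rw [hcoeff, quadratic_mul_coeff_one]
    change q 1 - S * q 0 = _
    rw [hq0, mul_one]
  have hc : ∀ j, (P.coeff (j + 2) : ℝ) = q j - S * q (j + 1) + q (j + 2) := fun j => by
    rw [hcoeff, quadratic_mul_coeff_add_two]
  have hc0 : (P.coeff 0 : ℝ) = 1 := by
    rw [hcoeff, mul_coeff_zero]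
    change _ * q 0 = 1
    rw [hq0]; simp
  have hctop1 : (P.coeff (2 * k + 3) : ℝ) = q 1 - S := by
    rw [hc (2 * k + 1), hqsymm, hqtop, hqhigh 0]; ring
  have hctop : (P.coeff (2 * k + 4) : ℝ) = 1 := by
    rw [hc (2 * k + 2), hqtop, hqhigh 0, hqhigh 1]; ring
  have hmid : ∀ j ≤ 2 * k, 0 ≤ -P.coeff (j + 2) ∧ -P.coeff (j + 2) < -P.coeff 1 := by
    intro j hj
    have h1 := hψ (j + 1) (by omega) (by omega)
    have h2 := hqmem j (by omega)
    have h3 := hqmem (j + 2) (by omega)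
    have h4 := hqmem 1 (by omega)
    have h5 := hc j
    change 1 / 40 ≤ q (j + 1) ∧ q (j + 1) ≤ 39 / 40 at h1
    -- The margin `200 / 40 = 5` outweighs the neighbouring coefficients of `cosPoly ψ`, each at
    -- most `1`.
    have h6 : 200 * (1 / 40) ≤ S * q (j + 1) := by
      apply mul_le_mul hSB h1.1 (by norm_num) (by linarith)
    have h7 : 200 * (1 / 40) ≤ S * (1 - q (j + 1)) := by
      apply mul_le_mul hSB (by linarith [h1.2]) (by norm_num) (by linarith)
    constructor
    · have : (0 : ℝ) ≤ ((-P.coeff (j + 2) : ℤ) : ℝ) := by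
        push_cast; linarith [h2.2, h3.2]
      exact_mod_cast this
    · have : ((-P.coeff (j + 2) : ℤ) : ℝ) < ((-P.coeff 1 : ℤ) : ℝ) := by
        push_cast; linarith [h2.1, h3.1, h4.2]
      exact_mod_cast this
  have hDpos : 2 ≤ -P.coeff 1 := by
    have h4 := hqmem 1 (by omega)
    have : (2 : ℝ) ≤ ((-P.coeff 1 : ℤ) : ℝ) := by push_cast; linarith [h4.2]
    exact_mod_cast this
  obtain ⟨D, hD⟩ := Int.eq_ofNat_of_zero_le (show 0 ≤ -P.coeff 1 by omega)
  have hD2 : 2 ≤ D := by omega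
  have hDr : (D : ℝ) = S - q 1 := by
    have : ((-P.coeff 1 : ℤ) : ℝ) = D := by rw [hD]; simp
    push_cast at this; linarith
  -- The negated coefficients of degrees `2k + 2` down to `2`, then `D - 1` twice: the low terms `D
  -- * B - 1` combine with `D - B`, left over from `(B ^ p - 1) * (B - D)`, into `(D - 1) * B + (D -
  -- 1)`.
  let y : ℕ → ℕ := fun i => if i < 2 * k + 1 then (-P.coeff (2 * k - i + 2)).toNat else D - 1
  have hy : ∀ i, y i < D := by
    intro i
    simp only [y]
    split_ifs with h
    · have := hmid (2 * k - i) (by omega)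
      omega
    · omega
  have hroot : ∑ j ∈ Finset.range (2 * k + 5), (P.coeff j : ℝ) * B ^ j = 0 := by
    have h1 : (P.map (Int.castRingHom ℝ)).eval B = 0 := by
      rw [hP, eval_mul]
      have : (X ^ 2 - C S * X + 1 : ℝ[X]).eval B = 0 := by
        simp only [eval_add, eval_sub, eval_mul, eval_pow, eval_X, eval_C, eval_one, hS]
        field_simp
        ring
      rw [this, zero_mul]
    have hdeg : (P.map (Int.castRingHom ℝ)).natDegree < 2 * k + 5 := by
      rw [hP]
      refine natDegree_mul_le.trans_lt ?_
      rw [quadratic_natDegree, cosPoly_natDegree, Fintype.card_fin]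
      omega
    rw [eval_eq_sum_range' hdeg] at h1
    simpa only [coeff_map, Int.coe_castRingHom, eq_intCast] using h1
  refine hasOnePeriodicExpansion_of_word (B := B) (D := D) (p := 2 * k + 3)
    (x := fun n => y (n % (2 * k + 3))) (by linarith) (by omega) (fun i => by simp)
    (fun i => hy _) ⟨2 * k + 1, ?_⟩ ?_
  · rw [Nat.mod_eq_of_lt (by omega)]
    simp only [y]
    rw [if_neg (by omega)]; omega
  · have e1 : ∑ i ∈ Finset.range (2 * k + 3), (y (i % (2 * k + 3)) : ℝ) * B ^ (2 * k + 3 - 1 - i)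
        = ∑ i ∈ Finset.range (2 * k + 1), (-(P.coeff (i + 2) : ℝ)) * B ^ (i + 2) +
          (D - 1) * B + (D - 1) := by
      rw [Finset.sum_range_succ, Finset.sum_range_succ]
      have hlast : ∀ i, 2 * k + 1 ≤ i → i < 2 * k + 3 → (y (i % (2 * k + 3)) : ℝ) = D - 1 := by
        intro i h1 h2
        rw [Nat.mod_eq_of_lt h2]
        simp only [y]
        rw [if_neg (by omega), Nat.cast_sub (by omega)]
        simp
      rw [hlast _ le_rfl (by omega), hlast _ (by omega) (by omega),
        show 2 * k + 3 - 1 - (2 * k + 1) = 1 by omega, show 2 * k + 3 - 1 - (2 * k + 1 + 1) = 0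
        by omega, pow_one, pow_zero, mul_one,
        ← Finset.sum_range_reflect (fun i => (-(P.coeff (i + 2) : ℝ)) * B ^ (i + 2))]
      congr 2
      refine Finset.sum_congr rfl fun i hi => ?_
      have hi := Finset.mem_range.1 hi
      rw [Nat.mod_eq_of_lt (by omega), show 2 * k + 1 - 1 - i = 2 * k - i by omega,
        show 2 * k + 3 - 1 - i = 2 * k - i + 2 by omega]
      congr 1
      simp only [y]
      rw [if_pos hi]
      have h1 := Int.toNat_of_nonneg (hmid (2 * k - i) (by omega)).1
      have h2 : (((-P.coeff (2 * k - i + 2)).toNat : ℤ) : ℝ) =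
        ((-P.coeff (2 * k - i + 2) : ℤ) : ℝ) := by rw [h1]
      push_cast at h2
      exact_mod_cast h2
    rw [e1]
    rw [Finset.sum_range_succ, Finset.sum_range_succ, Finset.sum_range_succ',
      Finset.sum_range_succ', hctop, hctop1, hc0, zero_add, hc1] at hroot
    simp only [neg_mul, Finset.sum_neg_distrib]
    have e2 : ∀ i, i + 1 + 1 = i + 2 := fun _ => rfl
    simp only [e2] at hroot
    rw [hDr]
    linear_combination hroot

end Digits

/-! ### Symmetric arcs on the circle. -/

section Arcs

open MeasureTheory

/-- The points of the circle `ℝ / ℤ` at distance less than `r` from `a` or `-a`. -/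
def symmArc (a r : ℝ) : Set UnitAddCircle :=
  Metric.ball (a : UnitAddCircle) r ∪ Metric.ball ((-a : ℝ) : UnitAddCircle) r

lemma isOpen_symmArc (a r : ℝ) : IsOpen (symmArc a r) :=
  Metric.isOpen_ball.union Metric.isOpen_ball

/-- The bounds on `a` keep `2a` at distance at least `2r` from `ℤ`, so the two balls are disjoint.
-/
lemma volume_symmArc {a r : ℝ} (hr : 0 < r) (h1 : r ≤ a) (h2 : a ≤ 1 / 2 - r) :
    volume (symmArc a r) = ENNReal.ofReal (4 * r) := by
  have hball : ∀ x : UnitAddCircle, volume (Metric.ball x r) = ENNReal.ofReal (2 * r) := by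
    intro x
    rw [← measure_congr (AddCircle.closedBall_ae_eq_ball (T := (1 : ℝ)) (x := x) (ε := r)),
      AddCircle.volume_closedBall, min_eq_right (by linarith)]
  rw [symmArc, measure_union _ Metric.isOpen_ball.measurableSet, hball, hball,
    ← ENNReal.ofReal_add (by linarith) (by linarith)]
  · congr 1; ring
  · refine Metric.ball_disjoint_ball ?_
    rw [dist_eq_norm, ← AddCircle.coe_sub, UnitAddCircle.norm_eq]
    set N := round (a - -a)
    rcases le_or_gt N 0 with h | h
    · have : (N : ℝ) ≤ 0 := by exact_mod_cast h
      rw [abs_of_nonneg (by linarith)]; linarith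
    · have : (1 : ℝ) ≤ N := by exact_mod_cast h
      rw [abs_of_nonpos (by linarith)]; linarith

/-- Only the cosine enters `cosPoly`, so a point near `-a` may be reflected to one near `a`. -/
lemma exists_angle_of_mem_symmArc {a r x : ℝ} (hx : (x : UnitAddCircle) ∈ symmArc a r) :
    ∃ ψ : ℝ, |ψ - 2 * Real.pi * a| ≤ 2 * Real.pi * r ∧
      Real.cos ψ = Real.cos (2 * Real.pi * x) := by
  have hpi := Real.pi_pos
  rcases hx with hx | hx
  · rw [Metric.mem_ball, dist_eq_norm, ← AddCircle.coe_sub, UnitAddCircle.norm_eq] at hx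
    set N := round (x - a)
    refine ⟨2 * Real.pi * x - N * (2 * Real.pi), ?_, Real.cos_sub_int_mul_two_pi _ _⟩
    have e : 2 * Real.pi * x - N * (2 * Real.pi) - 2 * Real.pi * a =
      2 * Real.pi * (x - a - N) := by ring
    rw [e, abs_mul, abs_of_pos (by positivity)]
    gcongr
  · rw [Metric.mem_ball, dist_eq_norm, ← AddCircle.coe_sub, UnitAddCircle.norm_eq] at hx
    set N := round (x - -a)
    refine ⟨-(2 * Real.pi * x - N * (2 * Real.pi)), ?_, ?_⟩
    · have e : -(2 * Real.pi * x - N * (2 * Real.pi)) - 2 * Real.pi * a =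
        -(2 * Real.pi * (x - -a - N)) := by ring
      rw [e, abs_neg, abs_mul, abs_of_pos (by positivity)]
      gcongr
    · rw [Real.cos_neg]; exact Real.cos_sub_int_mul_two_pi _ _

end Arcs

/-! ### Frequency of good exponents. -/

namespace IsSalemNumber

open MeasureTheory

variable {β : ℝ} (hβ : IsSalemNumber β)

include hβ

/-- The arguments of the conjugates in the upper half plane, as fractions of a full turn, are
independent over `ℤ` in `ℝ / ℤ`. -/
lemma arg_independent {ι : Type*} [Fintype ι] (e : ι ≃ upperConjugates β) (n : ι → ℤ)
    (h : ∑ i, n i • (((e i : ℂ).arg / (2 * Real.pi) : ℝ) : UnitAddCircle) = 0) : n = 0 := by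
  classical
  have hexp : ∀ i, ((AddCircle.toCircle
      (((e i : ℂ).arg / (2 * Real.pi) : ℝ) : UnitAddCircle) : Circle) : ℂ) = e i := by
    intro i
    have hn := hβ.norm_of_mem_upperConjugates (e i).2
    rw [AddCircle.toCircle_apply_mk, Circle.coe_exp]
    have h1 := Complex.norm_mul_exp_arg_mul_I (e i : ℂ)
    rw [hn, Complex.ofReal_one, one_mul] at h1
    rw [← h1]
    congr 2
    rw [h1]
    congr 1
    field_simp
  let N : ℂ → ℤ := fun z => if hz : z ∈ upperConjugates β then n (e.symm ⟨z, hz⟩) else 0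
  have hN : ∀ i, N (e i) = n i := fun i => by
    simp only [N, dif_pos (e i).2, Subtype.coe_eta, Equiv.symm_apply_apply]
  have hprod : ∏ z ∈ upperConjugates β, z ^ N z = 1 := by
    rw [← Finset.prod_coe_sort, ← e.prod_comp]
    have h2 := mFourier_eq_toCircle n
      (fun i => (((e i : ℂ).arg / (2 * Real.pi) : ℝ) : UnitAddCircle))
    rw [h, AddCircle.toCircle_zero, Circle.coe_one] at h2
    rw [← h2]
    simp only [UnitAddTorus.mFourier, ContinuousMap.coe_mk, fourier_apply,
      AddCircle.toCircle_zsmul, Circle.coe_zpow]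
    exact Finset.prod_congr rfl fun i _ => by rw [hN, hexp]
  funext i
  rw [← hN i]
  exact hβ.eq_zero_of_prod_zpow_eq_one hprod (e i).2

lemma re_pow_eq_cos {z : ℂ} (hz : z ∈ upperConjugates β) (m : ℕ) :
    (z ^ m).re = Real.cos (2 * Real.pi * (m * (z.arg / (2 * Real.pi)))) := by
  have hn := hβ.norm_of_mem_upperConjugates hz
  have h1 := Complex.norm_mul_exp_arg_mul_I z
  rw [hn, Complex.ofReal_one, one_mul] at h1
  rw [← Complex.exp_ofReal_mul_I_re]
  nth_rewrite 1 [← h1]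
  rw [← Complex.exp_nat_mul]
  congr 2
  push_cast
  field_simp

/-- A set of exponents of explicit positive lower density, all but finitely many of whose elements
yield `(1, p)`-periodic expansions. -/
theorem eventually_le_ncard_hasOnePeriodicExpansion {k : ℕ}
    (hk : (upperConjugates β).card = k) :
    ∀ᶠ M : ℕ in atTop, ((36 * (k + 1) ^ 2 : ℝ) ^ k)⁻¹ / 2 * M ≤
      ({m : ℕ | 1 ≤ m ∧ m ≤ M ∧ HasOnePeriodicExpansion (β ^ m)}.ncard : ℝ) := by
  classical
  have hk1 : 1 ≤ k := hk ▸ hβ.upperConjugates_nonempty.card_pos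
  have hk1' : (1 : ℝ) ≤ k := by exact_mod_cast hk1
  have hpi := Real.pi_pos
  obtain ⟨φ, hφ, hcoef⟩ := exists_angles_coeff_mem hk1
  let e : Fin k ≃ upperConjugates β := (Finset.equivFinOfCardEq hk).symm
  let t : UnitAddTorus (Fin k) := fun j => (((e j : ℂ).arg / (2 * Real.pi) : ℝ) : UnitAddCircle)
  -- Chosen so that `2πr` is the angular tolerance `π / (70 (k+1)²)`.
  set r : ℝ := 1 / (140 * (k + 1) ^ 2) with hr
  have hr0 : 0 < r := by positivity
  let U : Set (UnitAddTorus (Fin k)) := Set.univ.pi fun j => symmArc (φ j / (2 * Real.pi)) r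
  have hU : IsOpen U := isOpen_set_pi Set.finite_univ fun j _ => isOpen_symmArc _ _
  have hr6 : r ≤ 1 / (6 * k ^ 2) := by
    rw [hr]
    gcongr
    · norm_num
    · linarith
  have hvol : volume U = ENNReal.ofReal ((4 * r) ^ k) := by
    have h1 : volume U = ∏ j, volume (symmArc (φ j / (2 * Real.pi)) r) := volume_pi_pi _
    have h2 : ∀ j, volume (symmArc (φ j / (2 * Real.pi)) r) = ENNReal.ofReal (4 * r) := by
      intro j
      have e1 : Real.pi / (3 * k ^ 2) / (2 * Real.pi) = 1 / (6 * k ^ 2) := by field_simp; norm_num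
      refine volume_symmArc hr0 (hr6.trans ?_) (le_trans ?_ (sub_le_sub_left hr6 _))
      · rw [← e1]
        exact div_le_div_of_nonneg_right (hφ j).1 (by positivity)
      · rw [← e1]
        have := div_le_div_of_nonneg_right (hφ j).2 (show 0 ≤ 2 * Real.pi by positivity)
        rw [sub_div] at this
        have e2 : Real.pi / (2 * Real.pi) = 1 / 2 := by field_simp
        rwa [e2] at this
    rw [h1, Finset.prod_congr rfl fun j _ => h2 j, Finset.prod_const, Finset.card_univ,
      Fintype.card_fin, ENNReal.ofReal_pow (by positivity)]
  -- The volume is `(35 (k+1)²)^(-k)`; enlarging `35` to `36` gives the strict inequality needed,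
  -- and `36 (k+1)² = (3d)²`.
  set c : ℝ := ((36 * (k + 1) ^ 2 : ℝ) ^ k)⁻¹ with hc
  have hc0 : 0 < c := by positivity
  have hcU : ENNReal.ofReal c < volume U := by
    rw [hvol]
    refine (ENNReal.ofReal_lt_ofReal_iff (by positivity)).2 ?_
    rw [hc, ← inv_pow]
    refine pow_lt_pow_left₀ ?_ (by positivity) (by omega)
    rw [hr, mul_one_div, inv_eq_one_div, div_lt_div_iff₀ (by positivity) (by positivity)]
    have : 0 < ((k : ℝ) + 1) ^ 2 := by positivity
    linarith
  have hvisits := eventually_le_ncard_visits (t := t) (fun n => hβ.arg_independent e n) hU hc0.le hcU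
  obtain ⟨m₀, hm₀⟩ := pow_unbounded_of_one_lt 200 hβ.one_lt
  have hgood : ∀ m : ℕ, m₀ ≤ m → m ≠ 0 → m • t ∈ U → HasOnePeriodicExpansion (β ^ m) := by
    intro m hm hm0 hmU
    have hlarge : 200 ≤ β ^ m := hm₀.le.trans (pow_le_pow_right₀ hβ.one_lt.le hm)
    have hψ : ∀ j, ∃ ψ : ℝ, |ψ - φ j| ≤ Real.pi / (70 * (k + 1) ^ 2) ∧
        Real.cos ψ = ((e j : ℂ) ^ m).re := by
      intro j
      have h1 : (m • t) j ∈ symmArc (φ j / (2 * Real.pi)) r := hmU j (Set.mem_univ j)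
      have h2 : (m • t) j = ((m * ((e j : ℂ).arg / (2 * Real.pi)) : ℝ) : UnitAddCircle) := by
        rw [← nsmul_eq_mul, AddCircle.coe_nsmul]; rfl
      rw [h2] at h1
      obtain ⟨ψ, h3, h4⟩ := exists_angle_of_mem_symmArc h1
      refine ⟨ψ, ?_, by rw [h4, hβ.re_pow_eq_cos (e j).2]⟩
      have e1 : 2 * Real.pi * (φ j / (2 * Real.pi)) = φ j := by field_simp
      have e2 : 2 * Real.pi * r = Real.pi / (70 * (k + 1) ^ 2) := by
        rw [hr]; field_simp; norm_num
      rwa [e1, e2] at h3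
    choose ψ hψ1 hψ2 using hψ
    obtain ⟨P, hP⟩ := hβ.exists_int_polynomial hm0
    refine hasOnePeriodicExpansion_of_coeff hlarge hk1 (ψ := ψ) (P := P) ?_ (hcoef ψ hψ1)
    rw [hP, cosPoly, ← Finset.prod_coe_sort, ← e.prod_comp]
    simp only [hψ2]
  -- For `M ≥ M₁`, half of `c * M` absorbs the fewer than `m₀` exponents with `β ^ m` possibly too
  -- small.
  obtain ⟨M₁, hM₁⟩ := exists_nat_gt (2 * m₀ / c)
  filter_upwards [hvisits, eventually_ge_atTop M₁] with M h1 h2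
  have hfin : {m : ℕ | 1 ≤ m ∧ m ≤ M ∧ HasOnePeriodicExpansion (β ^ m)}.Finite :=
    (Set.finite_Icc 1 M).subset fun m hm => ⟨hm.1, hm.2.1⟩
  have hsub : {m : ℕ | 1 ≤ m ∧ m ≤ M ∧ m • t ∈ U} ⊆
      {m : ℕ | 1 ≤ m ∧ m ≤ M ∧ HasOnePeriodicExpansion (β ^ m)} ∪ (Finset.range m₀ : Set ℕ) := by
    intro m hm
    by_cases h : m < m₀
    · exact Or.inr (by simpa using h)
    · exact Or.inl ⟨hm.1, hm.2.1, hgood m (by omega) (by have := hm.1; omega) hm.2.2⟩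
  have hcard := (Set.ncard_le_ncard hsub (hfin.union (Finset.finite_toSet _))).trans
    (Set.ncard_union_le _ _)
  rw [Set.ncard_coe_finset, Finset.card_range] at hcard
  have hcard' : ({m : ℕ | 1 ≤ m ∧ m ≤ M ∧ m • t ∈ U}.ncard : ℝ) ≤
      ({m : ℕ | 1 ≤ m ∧ m ≤ M ∧ HasOnePeriodicExpansion (β ^ m)}.ncard : ℝ) + m₀ := by
    exact_mod_cast hcard
  have h3 : 2 * m₀ < c * M := by
    rw [div_lt_iff₀ hc0] at hM₁
    have : (M₁ : ℝ) ≤ M := by exact_mod_cast h2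
    nlinarith
  linarith

end IsSalemNumber

/-! ### Parry numbers and the final density bound. -/

lemma HasOnePeriodicExpansion.isParryNumber {β : ℝ} (hβ : 1 < β) (h : HasOnePeriodicExpansion β) :
    IsParryNumber β := by
  obtain ⟨c, hc, p, hp⟩ := h
  exact ⟨hβ, c, hc, 1, p, hp.1⟩

theorem theorem1 :
    ∃ c : ℕ → ℝ, (∀ d : ℕ, 0 < c d) ∧
      (∀ d : ℕ, 0 < d → ((3 * (d : ℝ)) ^ d)⁻¹ < c d) ∧
      ∀ (d : ℕ) (β : ℝ), IsSalemNumber β → (minpoly ℚ β).natDegree = d →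
        {m : ℕ | 0 < m ∧ IsParryNumber (β ^ m)}.Infinite ∧
        c d ≤ liminf (fun M : ℕ =>
          (({m : ℕ | 1 ≤ m ∧ m ≤ M ∧ HasOnePeriodicExpansion (β ^ m)}.ncard : ℕ) : ℝ) / (M : ℝ))
          atTop := by
  have hpos : ∀ d : ℕ, 0 < ((3 * (d : ℝ)) ^ d)⁻¹ := by
    intro d
    rcases Nat.eq_zero_or_pos d with rfl | hd
    · simp
    · have : (0 : ℝ) < d := by exact_mod_cast hd
      positivity
  -- The factor `2` makes the bound on `c d` strict.
  refine ⟨fun d => 2 * ((3 * (d : ℝ)) ^ d)⁻¹, fun d => by linarith [hpos d],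
    fun d _ => by linarith [hpos d], fun d β hβ hd => ?_⟩
  obtain ⟨k, hk⟩ : ∃ k, (upperConjugates β).card = k := ⟨_, rfl⟩
  have hdk : d = 2 * k + 2 := by
    have h1 := hβ.card_conjugates_eq
    have h2 : minpoly ℚ (β : ℂ) = minpoly ℚ β :=
      minpoly.algebraMap_eq (algebraMap ℝ ℂ).injective β
    rw [hβ.card_conjugates, h2, hd, hk] at h1
    exact h1
  have hev := hβ.eventually_le_ncard_hasOnePeriodicExpansion hk
  set c : ℝ := ((36 * (k + 1) ^ 2 : ℝ) ^ k)⁻¹ / 2 with hc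
  have hc0 : 0 < c := by positivity
  constructor
  · intro hfin
    obtain ⟨M₁, hM₁⟩ := exists_nat_gt
      (({m : ℕ | 0 < m ∧ IsParryNumber (β ^ m)}.ncard : ℝ) / c)
    obtain ⟨M, hM, hM'⟩ := (hev.and (eventually_ge_atTop M₁)).exists
    have hsub : {m : ℕ | 1 ≤ m ∧ m ≤ M ∧ HasOnePeriodicExpansion (β ^ m)} ⊆
        {m : ℕ | 0 < m ∧ IsParryNumber (β ^ m)} := fun m hm =>
      ⟨hm.1, hm.2.2.isParryNumber (one_lt_pow₀ hβ.one_lt (by have := hm.1; omega))⟩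
    have h1 : ({m : ℕ | 1 ≤ m ∧ m ≤ M ∧ HasOnePeriodicExpansion (β ^ m)}.ncard : ℝ) ≤
        ({m : ℕ | 0 < m ∧ IsParryNumber (β ^ m)}.ncard : ℝ) := by
      exact_mod_cast Set.ncard_le_ncard hsub hfin
    rw [div_lt_iff₀ hc0] at hM₁
    have h2 : (M₁ : ℝ) ≤ M := by exact_mod_cast hM'
    nlinarith
  -- A real `liminf` is meaningful only for bounded frequencies.
  · have hbound : ∀ M : ℕ, (({m : ℕ | 1 ≤ m ∧ m ≤ M ∧
        HasOnePeriodicExpansion (β ^ m)}.ncard : ℕ) : ℝ) / (M : ℝ) ≤ 1 := by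
      intro M
      refine div_le_one_of_le₀ ?_ (Nat.cast_nonneg _)
      have h1 : {m : ℕ | 1 ≤ m ∧ m ≤ M ∧ HasOnePeriodicExpansion (β ^ m)} ⊆
          (Finset.Icc 1 M : Set ℕ) := fun m hm => by simpa using ⟨hm.1, hm.2.1⟩
      have h2 := Set.ncard_le_ncard h1 (Finset.finite_toSet _)
      rw [Set.ncard_coe_finset, Nat.card_Icc] at h2
      exact_mod_cast h2
    refine le_liminf_of_le (isCoboundedUnder_ge_of_le _ hbound) ?_
    filter_upwards [hev, eventually_gt_atTop 0] with M hM hM0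
    have hM0' : (0 : ℝ) < M := by exact_mod_cast hM0
    rw [le_div_iff₀ hM0']
    refine le_trans ?_ hM
    gcongr
    rw [hdk, hc]
    push_cast
    have e1 : (3 * (2 * (k : ℝ) + 2)) ^ (2 * k + 2) =
        (36 * (k + 1) ^ 2) ^ k * (36 * (k + 1) ^ 2) := by
      rw [← pow_succ, show 2 * k + 2 = 2 * (k + 1) by ring, pow_mul]
      congr 1; ring
    rw [e1, mul_inv]
    -- The spare factor `36 (k+1)²` of `(3d)^d` pays for the factor `2` and for the halved density.
    have h3 : (36 * ((k : ℝ) + 1) ^ 2)⁻¹ ≤ 1 / 4 := by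
      rw [inv_eq_one_div]
      gcongr
      have : (0 : ℝ) ≤ k := Nat.cast_nonneg k
      nlinarith
    have h4 : 0 < ((36 * ((k : ℝ) + 1) ^ 2) ^ k)⁻¹ := by positivity
    nlinarith
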